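/- **Setting.** Let $V_{\mathbb R}\simeq\mathbb R^n$ carry a nondegenerate symmetric bilinear form $(\cdot,\cdot)$, extended $\mathbb C$-bilinearly to $V=\mathbb C\otimes V_{\mathbb R}\simeq\mathbb C^n$. Let $\Phi\subset V_{\mathbb R}$ be a root system, that is, a finite set of non-isotropic vectors that is stable under the reflections $\sigma_x(y)=y-\frac{2(y,x)}{(x,x)}x$, $x\in\Phi$, and such that $x,kx\in\Phi$ with $k\in\mathbb R$ implies $k=\pm1$. Let $G\subset GL(V)$ be the (finite) group generated by all $\sigma_x$, $x\in\Phi$. Fix a system of simple roots $\Psi\subset\Phi$ (linearly independent, every root being a combination of elements of $\Psi$ with all coefficients $\ge0$ or all $\le0$), the positive roots $\Phi^+$, the simple reflections $\Theta=\{\sigma_x: x\in\Psi\}$ and the length function $\ell$ with respect to $\Theta$. A subgroup of $G$ is called *parabolic* if it is generated by a subset of $\Theta$. Put $\gamma_x(y)=(x,y)$ and $\Delta=\prod_{x\in\Phi^+}\gamma_x$. For $y\in V$ let $\mathcal O_y\subset\mathcal M_y$ be the germs at $y$ of holomorphic and of meromorphic functions, and $\mathfrak M=\bigoplus_{y\in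 V}\mathcal M_y$. The group $G$ and the translations $\phi_\xi\colon y\mapsto \xi+y$, $\xi\in V$, act on functions and on $\mathfrak M$ by $f\mapsto f\circ e^{-1}$ (sending germs at $y$ to germs at $e(y)$), and global meromorphic functions act on $\mathfrak M$ by multiplication. Let $\mathcal S$ be the space of finite sums $\sum f_i\phi_{\xi_i}$ with $f_i$ meromorphic on $V$ and $\xi_i\in V$; it acts on $\mathfrak M$, and $G$ acts on it by $g\cdot(f\phi_\xi)=(g\cdot f)\phi_{g\xi}$. Let $\mathfrak O^G$ be the space of $G$-invariant elements of $\bigoplus_{y\in V}\mathcal O_y$. For $x\in\Psi$ put $\partial_{\sigma_x}=\gamma_x^{-1}(\mathrm{id}-\sigma_x)$ on $\mathfrak M$, and for $w\in G$ put $\partial_w=\partial_{\sigma_1}\circ\cdots\circ\partial_{\sigma_m}$, where $w=\sigma_1\cdots\sigma_m$ is a reduced expression. For subgroups $H\subset K$ of $G$, $(K/H)^{short}$ is the set of those $w\in K$ that have minimal length in $wH$. **Theorem (Structure Theorem).** Let $v\in V$ have a parabolic stabilizer $G_v$, let $\Delta'=\prod\gamma_x$ over all $x\in\Phi^+$ with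 $\sigma_x\in G_v$, and let $p$ be a $G_v$-invariant holomorphic function on $V$ (for example, a $G_v$-invariant polynomial). (a) If $w$ is the longest element of $(G/G_v)^{short}$, then there is a scalar $a\neq0$ with $$\sum_{\tau\in G}\tau\cdot\Big(\frac{\Delta'}{\Delta}\,p\,\phi_v\Big)\Big|_{\mathfrak O^G}=a\,\partial_w\circ p\,\phi_v\big|_{\mathfrak O^G}.$$ (b) Let $G'\subset G$ be any parabolic subgroup. Then there are representatives $\tau_1,\dots,\tau_k$ of the cosets in $G'\backslash G$ such that, with $v_s=\tau_s v$, all stabilizers $G'_{v_s}$ are parabolic, and meromorphic functions $t_1,\dots,t_k$ on $V$ such that $$\sum_{\tau\in G}\tau\cdot\Big(\frac{\Delta'}{\Delta}\,p\,\phi_v\Big)\Big|_{\mathfrak O^G}=\sum_{s=1}^k\partial_{w_s}\circ t_s\,\phi_{v_s}\big|_{\mathfrak O^G},$$ where $w_s$ is the longest element of $(G'/G'_{v_s})^{short}$. Moreover $t_s=r_s\cdot(\tau_s\cdot p)$ with $r_s$ a rational function, so that $t_s$ is rational if $p$ is a polynomial, and both $r_s$ and $t_s$ are regular at every point of $V$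 outside the hyperplanes $\ker\gamma_y$ with $y\in\Phi^+$, $\sigma_y\notin G'$; in particular they are regular on the Weyl chambers and at the generic points of the walls $\ker\gamma_x$ with $\sigma_x\in G'$. -/

import Mathlib

open Filter
open scoped Topology

noncomputable section

namespace ReflOrder

/-! ## Holomorphic and meromorphic functions on `ℂⁿ` and their germs -/

/-- The complex vector space `V = ℂⁿ`. -/
abbrev Cn (n : ℕ) : Type := Fin n → ℂ

variable {n : ℕ}

instance germAlgebra (x : Cn n) : Algebra ℂ (Germ (𝓝 x) ℂ) :=
  Algebra.ofModule
    (fun r f g => by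
      induction f using Germ.inductionOn with | _ f => ?_
      induction g using Germ.inductionOn with | _ g => ?_
      exact congrArg (fun h : Cn n → ℂ => (h : Germ (𝓝 x) ℂ)) (smul_mul_assoc r f g))
    (fun r f g => by
      induction f using Germ.inductionOn with | _ f => ?_
      induction g using Germ.inductionOn with | _ g => ?_
      exact congrArg (fun h : Cn n → ℂ => (h : Germ (𝓝 x) ℂ)) (mul_smul_comm r f g))

/-- The algebra `𝒪_x` of germs at `x` of holomorphic functions. -/
def HolGerm (x : Cn n) : Subalgebra ℂ (Germ (𝓝 x) ℂ) where
  carrier := {f | ∃ F : Cn n → ℂ, AnalyticAt ℂ F x ∧ (F : Germ (𝓝 x) ℂ) = f}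
  mul_mem' := by
    rintro _ _ ⟨F, hF, rfl⟩ ⟨H, hH, rfl⟩
    exact ⟨F * H, hF.mul hH, rfl⟩
  add_mem' := by
    rintro _ _ ⟨F, hF, rfl⟩ ⟨H, hH, rfl⟩
    exact ⟨F + H, hF.add hH, rfl⟩
  algebraMap_mem' := by
    intro r
    refine ⟨r • (1 : Cn n → ℂ), ?_, rfl⟩
    exact analyticAt_const (v := r * 1)

/-- The algebra of entire functions on `V`, that is, `H⁰(V, 𝒪)`. -/
def Hol (n : ℕ) : Subalgebra ℂ (Cn n → ℂ) where
  carrier := {f | ∀ x, AnalyticAt ℂ f x}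
  mul_mem' := fun hf hg x => (hf x).mul (hg x)
  add_mem' := fun hf hg x => (hf x).add (hg x)
  algebraMap_mem' := fun _ _ => analyticAt_const

/-- If a product of two functions that are analytic at `x` vanishes near `x`, so does a factor. -/
theorem eventually_zero_of_mul {f g : Cn n → ℂ} {x : Cn n} (hf : AnalyticAt ℂ f x)
    (hg : AnalyticAt ℂ g x) (h : ∀ᶠ y in 𝓝 x, f y * g y = 0) :
    (∀ᶠ y in 𝓝 x, f y = 0) ∨ (∀ᶠ y in 𝓝 x, g y = 0) := by
  obtain ⟨r, hr, hb⟩ := Metric.eventually_nhds_iff_ball.1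
    (hf.eventually_analyticAt.and (hg.eventually_analyticAt.and h))
  by_cases hz : ∀ y ∈ Metric.ball x r, f y = 0
  · exact Or.inl (Filter.mem_of_superset (Metric.ball_mem_nhds x hr) hz)
  · right
    push Not at hz
    obtain ⟨y, hy, hfy⟩ := hz
    have hne : ∀ᶠ z in 𝓝 y, f z ≠ 0 := (hb y hy).1.continuousAt.eventually_ne hfy
    have hgy : ∀ᶠ z in 𝓝 y, g z = 0 := by
      filter_upwards [hne, Metric.isOpen_ball.mem_nhds hy] with z hz hzb
      exact (mul_eq_zero.1 (hb z hzb).2.2).resolve_left hz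
    have hg' : AnalyticOnNhd ℂ g (Metric.ball x r) := fun z hz => (hb z hz).2.1
    have := hg'.eqOn_zero_of_preconnected_of_eventuallyEq_zero
      (convex_ball x r).isPreconnected hy hgy
    exact Filter.mem_of_superset (Metric.ball_mem_nhds x hr) this

instance holGerm_isDomain (x : Cn n) : IsDomain (HolGerm x) := by
  have : NoZeroDivisors (HolGerm x) := by
    refine ⟨?_⟩
    rintro ⟨_, F, hF, rfl⟩ ⟨_, H, hH, rfl⟩ h
    have h' : ((F * H : Cn n → ℂ) : Germ (𝓝 x) ℂ) = ((0 : Cn n → ℂ) : Germ (𝓝 x) ℂ) :=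
      congrArg Subtype.val h
    have h'' := eventually_zero_of_mul hF hH (Germ.coe_eq.1 h')
    rcases h'' with h0 | h0
    · exact Or.inl (Subtype.ext (Germ.coe_eq.2 h0))
    · exact Or.inr (Subtype.ext (Germ.coe_eq.2 h0))
  exact NoZeroDivisors.to_isDomain _

/-- The germ at `x` of an entire function. -/
def germHol (x : Cn n) : Hol n →+* HolGerm x where
  toFun f := ⟨((f : Cn n → ℂ) : Germ (𝓝 x) ℂ), f, f.2 x, rfl⟩
  map_one' := rfl
  map_mul' _ _ := rfl
  map_zero' := rfl
  map_add' _ _ := rfl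

theorem germHol_injective (x : Cn n) : Function.Injective (germHol x) := by
  intro f g h
  have h1 : ((f : Cn n → ℂ) : Germ (𝓝 x) ℂ) = ((g : Cn n → ℂ) : Germ (𝓝 x) ℂ) :=
    congrArg Subtype.val h
  exact Subtype.ext (AnalyticOnNhd.eq_of_eventuallyEq (fun y _ => f.2 y) (fun y _ => g.2 y)
    (Germ.coe_eq.1 h1))

instance hol_isDomain : IsDomain (Hol n) := (germHol_injective (0 : Cn n)).isDomain _

/-- Global meromorphic functions on `V = ℂⁿ`: quotients of entire functions. -/
abbrev Mer (n : ℕ) : Type := FractionRing (Hol n)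

/-- The algebra `ℳ_x` of germs at `x` of meromorphic functions. -/
abbrev MerGerm (x : Cn n) : Type := FractionRing (HolGerm x)

/-- The germ at `x` of a global meromorphic function. -/
def germMer (x : Cn n) : Mer n →+* MerGerm x :=
  IsFractionRing.map (germHol_injective x)

/-- The space `𝔐 = ⨁_{x ∈ V} ℳ_x`. -/
abbrev MerGerms (n : ℕ) : Type := DirectSum (Cn n) (fun x => MerGerm x)

/-- A meromorphic germ is holomorphic if it comes from `𝒪_x`. -/
def IsHolGerm {x : Cn n} (f : MerGerm x) : Prop :=
  f ∈ Set.range (algebraMap (HolGerm x) (MerGerm x))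

/-- A global meromorphic function is regular (defined) at `x`. -/
def RegularAt (f : Mer n) (x : Cn n) : Prop := IsHolGerm (germMer x f)

/-- A polynomial as an entire function. -/
def polyHol (P : MvPolynomial (Fin n) ℂ) : Hol n :=
  ⟨fun x => MvPolynomial.eval x P, fun x => AnalyticOnNhd.eval_mvPolynomial P x (Set.mem_univ x)⟩

/-- A global meromorphic function is rational if it is a quotient of polynomials. -/
def IsRational (f : Mer n) : Prop :=
  ∃ P Q : MvPolynomial (Fin n) ℂ, Q ≠ 0 ∧
    f = algebraMap (Hol n) (Mer n) (polyHol P) / algebraMap (Hol n) (Mer n) (polyHol Q)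

/-! ## Action of affine automorphisms of `V` on functions and germs

An affine automorphism `e` acts by `f ↦ f ∘ e⁻¹` and sends germs at `x` to germs at `e x`. -/

theorem affine_analyticAt (e : Cn n ≃ᵃ[ℂ] Cn n) (x : Cn n) : AnalyticAt ℂ (fun y => e y) x := by
  have h : (fun y => e y) = fun y => e.linear.toLinearMap.toContinuousLinearMap y + e 0 := by
    funext y
    have := e.map_vadd 0 y
    simpa using this
  rw [h]
  exact (ContinuousLinearMap.analyticAt _ x).add analyticAt_const

theorem affine_tendsto (e : Cn n ≃ᵃ[ℂ] Cn n) (x : Cn n) : Tendsto e (𝓝 x) (𝓝 (e x)) :=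
  (affine_analyticAt e x).continuousAt

theorem affine_symm_tendsto (e : Cn n ≃ᵃ[ℂ] Cn n) (x : Cn n) :
    Tendsto e.symm (𝓝 (e x)) (𝓝 x) := by
  simpa using affine_tendsto e.symm (e x)

/-- The isomorphism `𝒪_x → 𝒪_{e x}`, `f ↦ f ∘ e⁻¹`. -/
def pushHolGerm (e : Cn n ≃ᵃ[ℂ] Cn n) (x : Cn n) : HolGerm x ≃ₐ[ℂ] HolGerm (e x) where
  toFun f := ⟨(f : Germ (𝓝 x) ℂ).compTendsto e.symm (affine_symm_tendsto e x), by
    obtain ⟨_, F, hF, rfl⟩ := f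
    exact ⟨F ∘ e.symm, AnalyticAt.comp (by simpa using hF) (affine_analyticAt e.symm (e x)), rfl⟩⟩
  invFun f := ⟨(f : Germ (𝓝 (e x)) ℂ).compTendsto e (affine_tendsto e x), by
    obtain ⟨_, F, hF, rfl⟩ := f
    exact ⟨F ∘ e, hF.comp (affine_analyticAt e x), rfl⟩⟩
  left_inv := by
    rintro ⟨_, F, hF, rfl⟩
    refine Subtype.ext ?_
    change ((((F ∘ e.symm) ∘ e : Cn n → ℂ)) : Germ (𝓝 x) ℂ) = (F : Germ (𝓝 x) ℂ)
    congr 1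
    funext y
    simp
  right_inv := by
    rintro ⟨_, F, hF, rfl⟩
    refine Subtype.ext ?_
    change ((((F ∘ e) ∘ e.symm : Cn n → ℂ)) : Germ (𝓝 (e x)) ℂ) = (F : Germ (𝓝 (e x)) ℂ)
    congr 1
    funext y
    simp
  map_mul' := by
    rintro ⟨_, F, hF, rfl⟩ ⟨_, H, hH, rfl⟩
    rfl
  map_add' := by
    rintro ⟨_, F, hF, rfl⟩ ⟨_, H, hH, rfl⟩
    rfl
  commutes' := fun _ => rfl

/-- The isomorphism `ℳ_x → ℳ_{e x}`, `f ↦ f ∘ e⁻¹`. -/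
def pushMerGerm (e : Cn n ≃ᵃ[ℂ] Cn n) (x : Cn n) : MerGerm x ≃ₐ[ℂ] MerGerm (e x) :=
  IsFractionRing.algEquivOfAlgEquiv (pushHolGerm e x)

/-- The action of `e` on entire functions, `f ↦ f ∘ e⁻¹`. -/
def pushHol (e : Cn n ≃ᵃ[ℂ] Cn n) : Hol n ≃ₐ[ℂ] Hol n where
  toFun f := ⟨(f : Cn n → ℂ) ∘ e.symm, fun x => (f.2 _).comp (affine_analyticAt e.symm x)⟩
  invFun f := ⟨(f : Cn n → ℂ) ∘ e, fun x => (f.2 _).comp (affine_analyticAt e x)⟩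
  left_inv f := Subtype.ext (by funext y; simp)
  right_inv f := Subtype.ext (by funext y; simp)
  map_mul' _ _ := rfl
  map_add' _ _ := rfl
  commutes' _ := rfl

/-- The action of `e` on global meromorphic functions, `f ↦ f ∘ e⁻¹`. -/
def pushMer (e : Cn n ≃ᵃ[ℂ] Cn n) : Mer n ≃ₐ[ℂ] Mer n :=
  IsFractionRing.algEquivOfAlgEquiv (pushHol e)

/-! ## Operators on `𝔐` -/

/-- Multiplication by a global meromorphic function as an operator on `𝔐`. -/
def mulOp (f : Mer n) : Module.End ℂ (MerGerms n) :=
  DirectSum.lmap (fun x => LinearMap.mulLeft ℂ (germMer x f))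

open Classical in
/-- The operator on `𝔐` given by an affine automorphism of `V`. -/
def pushOp (e : Cn n ≃ᵃ[ℂ] Cn n) : Module.End ℂ (MerGerms n) :=
  DirectSum.toModule ℂ (Cn n) (MerGerms n)
    (fun x => DirectSum.lof ℂ (Cn n) (fun y => MerGerm y) (e x) ∘ₗ (pushMerGerm e x).toLinearMap)

/-- The translation `φ_ξ : x ↦ ξ + x` of `V`. -/
def translation (ξ : Cn n) : Cn n ≃ᵃ[ℂ] Cn n := AffineEquiv.constVAdd ℂ (Cn n) ξ

/-- The space `𝒮(V)` of finite sums `∑ fᵢ φ_{ξᵢ}` with `fᵢ` meromorphic on `V` and `ξᵢ ∈ V`;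
`f φ_ξ` is `Finsupp.single ξ f`. -/
abbrev Skew (n : ℕ) : Type := Cn n →₀ Mer n

/-- The action of `g ∈ GL(V)` on `𝒮(V)`: `g · (f φ_ξ) = (g · f) φ_{g ξ}`. -/
def Skew.act (g : Cn n ≃ₗ[ℂ] Cn n) (X : Skew n) : Skew n :=
  X.sum (fun ξ f => Finsupp.single (g ξ) (pushMer g.toAffineEquiv f))

/-- The action of `𝒮(V)` on `𝔐`: `f φ_ξ` translates a germ by `ξ` and multiplies it by `f`. -/
def Skew.op (X : Skew n) : Module.End ℂ (MerGerms n) :=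
  X.sum (fun ξ f => mulOp f * pushOp (translation ξ))

/-- The space `𝔒^G = ⨁_{x̄ ∈ V/G} 𝒪^G_{x̄}`: the `G`-invariant elements of
`⨁_{x ∈ V} 𝒪_x ⊆ 𝔐`. -/
def invHolGerms (G : Subgroup (Cn n ≃ₗ[ℂ] Cn n)) : Set (MerGerms n) :=
  {F | (∀ x, IsHolGerm (F x)) ∧ ∀ g ∈ G, pushOp g.toAffineEquiv F = F}

/-! ## Root systems, reflection groups and divided differences -/

/-- A root system `Φ` in the real vector space `ℝⁿ` with a nondegenerate symmetric bilinear form.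
The roots are non-isotropic, so that the reflections are defined; in particular they are
nonzero. -/
structure RootSys (n : ℕ) where
  form : LinearMap.BilinForm ℝ (Fin n → ℝ)
  symm : form.IsSymm
  nondegenerate : form.Nondegenerate
  roots : Finset (Fin n → ℝ)
  anisotropic : ∀ x ∈ roots, form x x ≠ 0
  refl_mem : ∀ x ∈ roots, ∀ y ∈ roots, y - (2 * form y x / form x x) • x ∈ roots
  reduced : ∀ x ∈ roots, ∀ k : ℝ, k • x ∈ roots → k = 1 ∨ k = -1

namespace RootSys

variable (R : RootSys n)

/-- The linear function `γ_x(y) = (x, y)` on `V = ℂ ⊗ ℝⁿ = ℂⁿ`, where `(·,·)` is extended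
`ℂ`-bilinearly. -/
def gammaLin (x : Fin n → ℝ) : Cn n →ₗ[ℂ] ℂ :=
  ∑ i, ((R.form x (Pi.single i 1) : ℝ) : ℂ) • LinearMap.proj i

/-- A real vector as an element of `V`. -/
def toCn (x : Fin n → ℝ) : Cn n := fun i => (x i : ℂ)

theorem gammaLin_toCn (x y : Fin n → ℝ) : R.gammaLin x (toCn y) = ((R.form x y : ℝ) : ℂ) := by
  have hy : R.form x y = ∑ i, R.form x (Pi.single i 1) * y i := by
    conv_lhs => rw [pi_eq_sum_univ' y]
    rw [map_sum]
    refine Finset.sum_congr rfl fun i _ => ?_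
    rw [map_smul, smul_eq_mul, mul_comm]
  rw [hy]
  simp [gammaLin, toCn]

/-- The reflection `σ_x(y) = y - (2 (y, x) / (x, x)) x` of `V`. -/
def refl (x : Fin n → ℝ) : Cn n ≃ₗ[ℂ] Cn n :=
  LinearEquiv.ofInvolutive
    (LinearMap.id - (((2 / R.form x x : ℝ) : ℂ) • R.gammaLin x).smulRight (toCn x)) (by
      intro y
      simp only [LinearMap.sub_apply, LinearMap.id_apply, LinearMap.smulRight_apply,
        LinearMap.smul_apply, smul_eq_mul, map_sub, map_smul, gammaLin_toCn]
      by_cases h : R.form x x = 0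
      · simp [h]
      · have hc : ((R.form x x : ℝ) : ℂ) ≠ 0 := by exact_mod_cast h
        push_cast
        ext i
        simp only [Pi.sub_apply, Pi.smul_apply, smul_eq_mul]
        field_simp
        ring)

theorem refl_apply (x : Fin n → ℝ) (y : Cn n) :
    R.refl x y = y - (((2 / R.form x x : ℝ) : ℂ) * R.gammaLin x y) • toCn x := rfl

/-- The reflection group `G ⊆ GL(V)` generated by all `σ_x`, `x ∈ Φ`. -/
def group : Subgroup (Cn n ≃ₗ[ℂ] Cn n) := Subgroup.closure (R.refl '' (R.roots : Set (Fin n → ℝ)))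

theorem form_comm (x y : Fin n → ℝ) : R.form x y = R.form y x := by
  simpa using R.symm.eq x y

/-- The real reflection `y - (2 (y, x) / (x, x)) x`. -/
def realRefl (x y : Fin n → ℝ) : Fin n → ℝ := y - (2 * R.form y x / R.form x x) • x

theorem refl_toCn (x y : Fin n → ℝ) : R.refl x (toCn y) = toCn (R.realRefl x y) := by
  rw [refl_apply, gammaLin_toCn, R.form_comm x y]
  ext i
  simp only [toCn, realRefl, Pi.sub_apply, Pi.smul_apply, smul_eq_mul]
  push_cast
  ring

theorem gammaLin_realRefl (x y : Fin n → ℝ) (z : Cn n) :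
    R.gammaLin (R.realRefl x y) z =
      R.gammaLin y z - ((2 * R.form y x / R.form x x : ℝ) : ℂ) * R.gammaLin x z := by
  simp only [gammaLin, realRefl, map_sub, map_smul, LinearMap.sub_apply, LinearMap.smul_apply,
    smul_eq_mul, LinearMap.coe_sum, Finset.sum_apply, LinearMap.proj_apply, Finset.mul_sum]
  rw [← Finset.sum_sub_distrib]
  refine Finset.sum_congr rfl fun i _ => ?_
  push_cast
  ring

theorem gammaLin_refl {x : Fin n → ℝ} (hx : R.form x x ≠ 0) (y : Fin n → ℝ) (z : Cn n) :
    R.gammaLin (R.realRefl x y) (R.refl x z) = R.gammaLin y z := by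
  have hc : ((R.form x x : ℝ) : ℂ) ≠ 0 := by exact_mod_cast hx
  rw [gammaLin_realRefl, refl_apply]
  simp only [map_sub, map_smul, gammaLin_toCn, smul_eq_mul]
  push_cast
  field_simp
  ring

theorem realRefl_realRefl {x : Fin n → ℝ} (hx : R.form x x ≠ 0) (y : Fin n → ℝ) :
    R.realRefl x (R.realRefl x y) = y := by
  ext i
  simp only [realRefl, map_sub, map_smul, LinearMap.sub_apply, LinearMap.smul_apply,
    smul_eq_mul, Pi.sub_apply, Pi.smul_apply]
  field_simp
  ring

theorem realRefl_mem {x y : Fin n → ℝ} (hx : x ∈ R.roots) (hy : y ∈ R.roots) :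
    R.realRefl x y ∈ R.roots := R.refl_mem x hx y hy

/-- The operator `y ↦ ∑_{α ∈ Φ} (α, y) α` on `V`. -/
def rootOp : Cn n →ₗ[ℂ] Cn n := ∑ α ∈ R.roots, (R.gammaLin α).smulRight (toCn α)

theorem rootOp_toCn {x : Fin n → ℝ} (hx : x ∈ R.roots) :
    ∃ t : ℂ, t ≠ 0 ∧ R.rootOp (toCn x) = t • toCn x := by
  have hxx := R.anisotropic x hx
  set q : ℝ := ∑ α ∈ R.roots, R.form α x ^ 2 with hq
  have hq0 : 0 < q := lt_of_lt_of_le (by positivity : 0 < R.form x x ^ 2)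
    (Finset.single_le_sum (f := fun α => R.form α x ^ 2) (fun α _ => sq_nonneg _) hx)
  have key : ∑ α ∈ R.roots, R.form α x • α = (q / R.form x x) • x := by
    have h1 : ∑ α ∈ R.roots, R.form α x • α =
        ∑ α ∈ R.roots, R.form (R.realRefl x α) x • R.realRefl x α :=
      (Finset.sum_nbij' (R.realRefl x) (R.realRefl x) (fun a ha => R.realRefl_mem hx ha)
        (fun a ha => R.realRefl_mem hx ha) (fun a _ => R.realRefl_realRefl hxx a)
        (fun a _ => R.realRefl_realRefl hxx a) (fun a _ => rfl)).symm
    have h2 : ∀ α, R.form (R.realRefl x α) x • R.realRefl x α =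
        -(R.form α x • α) + (2 * R.form α x ^ 2 / R.form x x) • x := by
      intro α
      ext i
      simp only [realRefl, map_sub, map_smul, LinearMap.sub_apply, LinearMap.smul_apply,
        smul_eq_mul, Pi.sub_apply, Pi.smul_apply, Pi.add_apply, Pi.neg_apply]
      field_simp
      ring
    simp only [h2, Finset.sum_add_distrib, Finset.sum_neg_distrib, ← Finset.sum_smul] at h1
    have h3 : ∑ α ∈ R.roots, 2 * R.form α x ^ 2 / R.form x x = 2 * (q / R.form x x) := by
      rw [← Finset.sum_div, ← Finset.mul_sum, mul_div_assoc]
    rw [h3, mul_smul, two_smul] at h1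
    have h4 := eq_neg_add_iff_add_eq.1 (h1.trans (by rfl))
    rw [← two_smul ℝ, ← two_smul ℝ] at h4
    exact smul_right_injective _ (two_ne_zero (α := ℝ)) h4
  refine ⟨((q / R.form x x : ℝ) : ℂ), by exact_mod_cast (div_ne_zero hq0.ne' hxx), ?_⟩
  ext i
  have := congrArg (fun r : ℝ => (r : ℂ)) (congrFun key i)
  simpa [rootOp, gammaLin_toCn, toCn, Finset.sum_apply] using this

/-- A vector in the span of the roots that is orthogonal to all roots is zero. -/
theorem eq_zero_of_orthogonal {u : Cn n}
    (hu : u ∈ Submodule.span ℂ (toCn '' (R.roots : Set (Fin n → ℝ))))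
    (h : ∀ x ∈ R.roots, R.gammaLin x u = 0) : u = 0 := by
  set S := Submodule.span ℂ (toCn '' (R.roots : Set (Fin n → ℝ))) with hS
  have hmap : ∀ y ∈ S, R.rootOp y ∈ S := by
    intro y _
    simp only [rootOp, LinearMap.coe_sum, Finset.sum_apply, LinearMap.smulRight_apply]
    exact S.sum_mem fun α hα => S.smul_mem _ (Submodule.subset_span ⟨α, hα, rfl⟩)
  have hsurj : Function.Surjective (R.rootOp.restrict hmap) := by
    rw [← LinearMap.range_eq_top, eq_top_iff]
    rintro ⟨y, hy⟩ -
    have : S ≤ (LinearMap.range (R.rootOp.restrict hmap)).map S.subtype := by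
      refine Submodule.span_le.2 ?_
      rintro _ ⟨x, hx, rfl⟩
      obtain ⟨t, ht, hT⟩ := R.rootOp_toCn hx
      have hxS : toCn x ∈ S := Submodule.subset_span ⟨x, hx, rfl⟩
      refine ⟨⟨toCn x, hxS⟩, ⟨⟨t⁻¹ • toCn x, S.smul_mem _ hxS⟩, ?_⟩, rfl⟩
      ext1
      simp [LinearMap.restrict_apply, hT, smul_smul, inv_mul_cancel₀ ht]
    obtain ⟨z, hz, hzy⟩ := this hy
    have : z = ⟨y, hy⟩ := Subtype.ext hzy
    rwa [this] at hz
  have hinj := LinearMap.injective_iff_surjective.2 hsurj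
  have h0 : R.rootOp.restrict hmap ⟨u, hu⟩ = R.rootOp.restrict hmap 0 := by
    ext1
    rw [map_zero]
    simp only [LinearMap.restrict_apply, rootOp, LinearMap.coe_sum, Finset.sum_apply,
      LinearMap.smulRight_apply, ZeroMemClass.coe_zero]
    exact Finset.sum_eq_zero fun α hα => by rw [h α hα, zero_smul]
  exact congrArg Subtype.val (hinj h0)

theorem group_permutes {g : Cn n ≃ₗ[ℂ] Cn n} (hg : g ∈ R.group) :
    (∀ x ∈ R.roots, ∃ x' ∈ R.roots, g (toCn x) = toCn x' ∧
      ∀ y, R.gammaLin x' (g y) = R.gammaLin x y) ∧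
    ∀ y, g y - y ∈ Submodule.span ℂ (toCn '' (R.roots : Set (Fin n → ℝ))) := by
  have hinv : ∀ z ∈ R.refl '' (R.roots : Set (Fin n → ℝ)),
      z⁻¹ ∈ R.refl '' (R.roots : Set (Fin n → ℝ)) := by
    rintro _ ⟨z, hz, rfl⟩
    exact ⟨z, hz, rfl⟩
  have hg' : g ∈ Submonoid.closure (R.refl '' (R.roots : Set (Fin n → ℝ))) := by
    have : g ∈ (Subgroup.closure (R.refl '' (R.roots : Set (Fin n → ℝ)))).toSubmonoid := hg
    rw [Subgroup.closure_toSubmonoid] at this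
    rwa [Set.union_eq_self_of_subset_right] at this
    intro z hz
    simpa using hinv _ hz
  induction hg' using Submonoid.closure_induction with
  | mem z hz =>
    obtain ⟨z, hz, rfl⟩ := hz
    refine ⟨fun x hx => ⟨R.realRefl z x, R.realRefl_mem hz hx, R.refl_toCn z x,
      R.gammaLin_refl (R.anisotropic z hz) x⟩, fun y => ?_⟩
    rw [refl_apply, sub_sub_cancel_left]
    exact Submodule.neg_mem _ (Submodule.smul_mem _ _ (Submodule.subset_span ⟨z, hz, rfl⟩))
  | one => exact ⟨fun x hx => ⟨x, hx, rfl, fun y => rfl⟩, fun y => by simp⟩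
  | mul a b ha hb iha ihb =>
    have hcl : ∀ c ∈ Submonoid.closure (R.refl '' (R.roots : Set (Fin n → ℝ))), c ∈ R.group :=
      fun c hc => (Submonoid.closure_le (S := R.group.toSubmonoid)).2 Subgroup.subset_closure hc
    have iha := iha (hcl a ha)
    have ihb := ihb (hcl b hb)
    refine ⟨fun x hx => ?_, fun y => ?_⟩
    · obtain ⟨x', hx', h1, h2⟩ := ihb.1 x hx
      obtain ⟨x'', hx'', h3, h4⟩ := iha.1 x' hx'
      exact ⟨x'', hx'', by rw [LinearEquiv.mul_apply, h1, h3], fun y => by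
        rw [LinearEquiv.mul_apply, h4, h2]⟩
    · have := Submodule.add_mem _ (iha.2 (b y)) (ihb.2 y)
      rwa [sub_add_sub_cancel] at this

theorem toCn_injective : Function.Injective (toCn (n := n)) := fun x y h => by
  ext i
  exact Complex.ofReal_injective (congrFun h i)

/-- The reflection group of a root system is finite. -/
instance group_finite : Finite R.group := by
  choose! f hf using fun (g : R.group) => (R.group_permutes g.2).1
  refine Finite.of_injective
    (fun g : R.group => fun x : R.roots => (⟨f g x, (hf g x x.2).1⟩ : R.roots)) ?_
  intro g h hgh
  have hfix : ∀ x ∈ R.roots, f g x = f h x := fun x hx =>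
    congrArg Subtype.val (congrFun hgh ⟨x, hx⟩)
  refine Subtype.ext (LinearEquiv.ext fun y => ?_)
  refine sub_eq_zero.1 (R.eq_zero_of_orthogonal ?_ ?_)
  · have := Submodule.sub_mem _ ((R.group_permutes g.2).2 y) ((R.group_permutes h.2).2 y)
    rwa [sub_sub_sub_cancel_right] at this
  · intro x hx
    have hsurj : ∃ z ∈ R.roots, f g z = x := by
      have hinj : Function.Injective
          (fun x : R.roots => (⟨f g x, (hf g x x.2).1⟩ : R.roots)) := by
        intro a b hab
        have h1 : f g a = f g b := congrArg Subtype.val hab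
        have h2 : (g : Cn n ≃ₗ[ℂ] Cn n) (toCn a) = (g : Cn n ≃ₗ[ℂ] Cn n) (toCn b) := by
          rw [(hf g a a.2).2.1, (hf g b b.2).2.1, h1]
        exact Subtype.ext (toCn_injective (LinearEquiv.injective _ h2))
      obtain ⟨z, hz⟩ := Finite.surjective_of_injective hinj ⟨x, hx⟩
      exact ⟨z, z.2, congrArg Subtype.val hz⟩
    obtain ⟨z, hz, hzx⟩ := hsurj
    have h1 := (hf g z hz).2.2 y
    have h2 := (hf h z hz).2.2 y
    rw [hzx] at h1
    rw [← hfix z hz, hzx] at h2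
    rw [map_sub, h1, h2, sub_self]

instance group_fintype : Fintype R.group := Fintype.ofFinite _

/-- `Ψ` is a system of simple roots of `Φ`. -/
def IsBase (Ψ : Finset (Fin n → ℝ)) : Prop :=
  Ψ ⊆ R.roots ∧ LinearIndepOn ℝ id (Ψ : Set (Fin n → ℝ)) ∧
    ∀ x ∈ R.roots, x ∈ Submodule.span NNReal (Ψ : Set (Fin n → ℝ)) ∨
      -x ∈ Submodule.span NNReal (Ψ : Set (Fin n → ℝ))

open Classical in
/-- The positive roots `Φ⁺` with respect to `Ψ`. -/
def posRoots (Ψ : Finset (Fin n → ℝ)) : Finset (Fin n → ℝ) :=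
  R.roots.filter (fun x => x ∈ Submodule.span NNReal (Ψ : Set (Fin n → ℝ)))

/-- The subgroup `H` is (standard) parabolic: generated by a set of simple reflections. -/
def IsParabolic (Ψ : Finset (Fin n → ℝ)) (H : Subgroup (Cn n ≃ₗ[ℂ] Cn n)) : Prop :=
  ∃ J : Finset (Fin n → ℝ), J ⊆ Ψ ∧ H = Subgroup.closure (R.refl '' (J : Set (Fin n → ℝ)))

/-- `γ_x` as an entire function. -/
def gamma (x : Fin n → ℝ) : Hol n :=
  ⟨fun y => R.gammaLin x y, fun y =>
    (ContinuousLinearMap.analyticAt (R.gammaLin x).toContinuousLinearMap y)⟩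

/-- `γ_x` as a global meromorphic function. -/
def gammaMer (x : Fin n → ℝ) : Mer n := algebraMap (Hol n) (Mer n) (R.gamma x)

open Classical in
/-- The product of all `γ_x` with `x` a positive root and `σ_x ∈ H`. For `H = G` this is the
product `Δ` over all positive roots, for `H = G_v` it is `Δ'`. -/
def delta (Ψ : Finset (Fin n → ℝ)) (H : Subgroup (Cn n ≃ₗ[ℂ] Cn n)) : Mer n :=
  ∏ x ∈ (R.posRoots Ψ).filter (fun x => R.refl x ∈ H), R.gammaMer x

/-- The divided difference operator `∂_{σ_x} = γ_x⁻¹ (id - σ_x)` on `𝔐`. -/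
def divDiffRoot (x : Fin n → ℝ) : Module.End ℂ (MerGerms n) :=
  mulOp (R.gammaMer x)⁻¹ * (1 - pushOp (R.refl x).toAffineEquiv)

/-- The list `l` of simple roots gives an expression of `w` as a product of simple reflections. -/
def IsExpr (Ψ : Finset (Fin n → ℝ)) (w : Cn n ≃ₗ[ℂ] Cn n) (l : List (Fin n → ℝ)) : Prop :=
  (∀ x ∈ l, x ∈ Ψ) ∧ (l.map R.refl).prod = w

/-- The length of `w` with respect to the simple reflections. -/
def len (Ψ : Finset (Fin n → ℝ)) (w : Cn n ≃ₗ[ℂ] Cn n) : ℕ :=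
  sInf {k | ∃ l, R.IsExpr Ψ w l ∧ l.length = k}

/-- A reduced expression of `w`. -/
def IsReducedExpr (Ψ : Finset (Fin n → ℝ)) (w : Cn n ≃ₗ[ℂ] Cn n) (l : List (Fin n → ℝ)) : Prop :=
  R.IsExpr Ψ w l ∧ l.length = R.len Ψ w

open Classical in
/-- The operator `∂_w = ∂_{σ₁} ∘ ⋯ ∘ ∂_{σ_p}` for `w ∈ G`, where `w = σ₁ ⋯ σ_p` is a reduced
expression (it does not depend on the reduced expression). -/
def divDiff (Ψ : Finset (Fin n → ℝ)) (w : Cn n ≃ₗ[ℂ] Cn n) : Module.End ℂ (MerGerms n) :=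
  if h : ∃ l, R.IsReducedExpr Ψ w l then (h.choose.map R.divDiffRoot).prod else 0

/-- The stabilizer of `v` in the subgroup `K`. -/
def stab (K : Subgroup (Cn n ≃ₗ[ℂ] Cn n)) (v : Cn n) : Subgroup (Cn n ≃ₗ[ℂ] Cn n) :=
  K ⊓ MulAction.stabilizer (Cn n ≃ₗ[ℂ] Cn n) v

/-- `w ∈ (K/H)^{short}`: `w ∈ K` has minimal length in the coset `w H`. -/
def IsShort (Ψ : Finset (Fin n → ℝ)) (K H : Subgroup (Cn n ≃ₗ[ℂ] Cn n))
    (w : Cn n ≃ₗ[ℂ] Cn n) : Prop :=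
  w ∈ K ∧ ∀ h ∈ H, R.len Ψ w ≤ R.len Ψ (w * h)

/-- `w` is the longest element of `(K/H)^{short}`. -/
def IsLongestShort (Ψ : Finset (Fin n → ℝ)) (K H : Subgroup (Cn n ≃ₗ[ℂ] Cn n))
    (w : Cn n ≃ₗ[ℂ] Cn n) : Prop :=
  R.IsShort Ψ K H w ∧ ∀ u, R.IsShort Ψ K H u → R.len Ψ u ≤ R.len Ψ w

/-- The element `∑_{τ ∈ G} τ · ((Δ'/Δ) p φ_v)` of `𝒮(V)`. -/
def orbitSum (Ψ : Finset (Fin n → ℝ)) (v : Cn n) (p : Hol n) : Skew n :=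
  ∑ τ : R.group, Skew.act (τ : Cn n ≃ₗ[ℂ] Cn n) (Finsupp.single v
    (R.delta Ψ (stab R.group v) / R.delta Ψ R.group * algebraMap (Hol n) (Mer n) p))

end RootSys

end ReflOrder

end

/-!
Both parts rest on one identity for a parabolic subgroup `K` of `G`. Let `N_K` be the number of
positive roots whose reflections lie in `K` and let `Δ_K` be the product of the corresponding
linear forms.

A product of divided differences `γ_x⁻¹ (1 - σ_x)` over a word in the simple roots of `K` expands
as a sum of terms `c_g g` over `g ∈ K`, with meromorphic coefficients `c_g` (`wordCoeff`,
`foldr_divDiff_eq_sum`). By induction on the word, `c_g = P_g / Δ_K` with polynomials `P_g` such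
that `deg P_g + length ≤ N_K` unless `P_g = 0`, and such that `γ_β` divides `P_g + P_{σ_β g}` for
every root `β` of `K`: a function minus its reflection vanishes on the mirror, so each divided
difference creates no new pole (`IsNumerator`, `IsNumerator.step`). A word of length `N_K`
therefore has constant numerators, and the divisibility by `γ_β` makes them alternate. Such a word
is a multiple of the antisymmetrizer, `∑ g ∘ Δ_K⁻¹` over `g ∈ K` up to a scalar
(`exists_wordCoeff_eq`, `prod_divDiffRoot_eq_sum`).

Now let `H ⊆ K` be parabolic, `w` the longest of the shortest coset representatives of `K / H`,
and `F` an `H`-invariant element of `𝔐`. A reduced expression of `w` followed by one of the longest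
element of `H` is a word of length `N_K`, with a nonzero coefficient. The word of the longest
element of `H` turns `Δ_H F` into a nonzero multiple of `F`. So `∂_w F` is a nonzero multiple of the
symmetrization of `(Δ_H / Δ_K) F` over `K`: this is `IsLongestShort.exists_sum_eq_smul_divDiff`.
For `K = G`, `H = G_v` and the germ `p φ_v F`, with `F` an invariant holomorphic germ, it is
part (a).

For part (b) the sum over `G` is split into the cosets `G' τ`, with `τ` chosen so that `τ⁻¹` keeps
the simple roots of `G'` positive (`exists_coset_reps`). The stabilizer of `v` in `G` being
parabolic, it is also the stabilizer of a dominant real functional, and its transport by `τ` is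
dominant for `G'`; hence the stabilizer of `τ v` in `G'` is parabolic (`IsBase.isParabolic_stab`).
The terms of the coset of `τ` form a symmetrization over `G'`, to which the identity above applies
with `K = G'` and `H = G'_{τ v}`. The remaining factor is, up to a scalar, the reciprocal of the
product of the `γ_y` over the positive roots `y` with `σ_y ∉ G'` and `σ_y (τ v) ≠ τ v`
(`polePoly`, `exists_pushMer_delta_div`). It is invariant under `G'_{τ v}` and its poles lie on the
mirrors of reflections outside `G'`.
-/

noncomputable section

namespace ReflOrder

variable {n : ℕ}

/-! ### Operators on the space of meromorphic germs -/

section Operators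

-- Shortcuts that keep instance search on these deeply nested types short.
local instance : Field (Mer n) := inferInstance
local instance : CommRing (Mer n) := inferInstance
local instance : AddCommGroup (MerGerms n) := inferInstance
local instance : AddCommMonoid (MerGerms n) := inferInstance
local instance : Module ℂ (MerGerms n) := inferInstance
local instance : DistribMulAction ℂ (MerGerms n) := inferInstance
local instance (x : Cn n) : Field (MerGerm x) := inferInstance
local instance (x : Cn n) : CommRing (MerGerm x) := inferInstance
local instance (x : Cn n) : NonAssocSemiring (MerGerm x) := inferInstance
local instance : NonAssocSemiring (Mer n) := inferInstance

theorem pushMerGerm_algebraMap (e : Cn n ≃ᵃ[ℂ] Cn n) (x : Cn n) (f : HolGerm x) :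
    pushMerGerm e x (algebraMap (HolGerm x) (MerGerm x) f) =
      algebraMap (HolGerm (e x)) (MerGerm (e x)) (pushHolGerm e x f) := by
  simp [pushMerGerm]

theorem pushMer_algebraMap (e : Cn n ≃ᵃ[ℂ] Cn n) (f : Hol n) :
    pushMer e (algebraMap (Hol n) (Mer n) f) = algebraMap (Hol n) (Mer n) (pushHol e f) := by
  simp [pushMer]

theorem germMer_algebraMap (x : Cn n) (f : Hol n) :
    germMer x (algebraMap (Hol n) (Mer n) f) =
      algebraMap (HolGerm x) (MerGerm x) (germHol x f) := by
  simp [germMer, IsFractionRing.map]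

theorem germMer_pushMer (e : Cn n ≃ᵃ[ℂ] Cn n) (x : Cn n) (f : Mer n) :
    germMer (e x) (pushMer e f) = pushMerGerm e x (germMer x f) := by
  obtain ⟨a, b, -, rfl⟩ := IsFractionRing.div_surjective (A := Hol n) f
  simp only [map_div₀, pushMer_algebraMap, germMer_algebraMap, pushMerGerm_algebraMap]
  rfl

theorem pushMer_mul (e e' : Cn n ≃ᵃ[ℂ] Cn n) (f : Mer n) :
    pushMer (e * e') f = pushMer e (pushMer e' f) := by
  obtain ⟨a, b, -, rfl⟩ := IsFractionRing.div_surjective (A := Hol n) f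
  simp only [map_div₀, pushMer_algebraMap]
  rfl

theorem pushMer_one (f : Mer n) : pushMer (1 : Cn n ≃ᵃ[ℂ] Cn n) f = f := by
  obtain ⟨a, b, -, rfl⟩ := IsFractionRing.div_surjective (A := Hol n) f
  simp only [map_div₀, pushMer_algebraMap]
  rfl

theorem pushMer_map_mul (e : Cn n ≃ᵃ[ℂ] Cn n) (f g : Mer n) :
    pushMer e (f * g) = pushMer e f * pushMer e g := (pushMer e).map_mul' f g

theorem pushMer_map_div (e : Cn n ≃ᵃ[ℂ] Cn n) (f g : Mer n) :
    pushMer e (f / g) = pushMer e f / pushMer e g := map_div₀ (pushMer e) f g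

theorem pushMerGerm_mul (e e' : Cn n ≃ᵃ[ℂ] Cn n) (x : Cn n) (f : MerGerm x) :
    pushMerGerm (e * e') x f = pushMerGerm e (e' x) (pushMerGerm e' x f) := by
  obtain ⟨a, b, -, rfl⟩ := IsFractionRing.div_surjective (A := HolGerm x) f
  simp only [map_div₀, pushMerGerm_algebraMap]
  obtain ⟨_, A, hA, rfl⟩ := a
  obtain ⟨_, B, hB, rfl⟩ := b
  rfl

theorem pushMerGerm_one (x : Cn n) (f : MerGerm x) :
    pushMerGerm (1 : Cn n ≃ᵃ[ℂ] Cn n) x f = f := by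
  obtain ⟨a, b, -, rfl⟩ := IsFractionRing.div_surjective (A := HolGerm x) f
  simp only [map_div₀, pushMerGerm_algebraMap]
  obtain ⟨_, A, hA, rfl⟩ := a
  obtain ⟨_, B, hB, rfl⟩ := b
  rfl

open Classical in
theorem pushOp_of (e : Cn n ≃ᵃ[ℂ] Cn n) (x : Cn n) (f : MerGerm x) :
    pushOp e (DirectSum.of (fun x : Cn n => MerGerm x) x f) =
      DirectSum.of (fun x : Cn n => MerGerm x) (e x) (pushMerGerm e x f) :=
  DirectSum.toModule_lof ℂ x f

open Classical in
theorem mulOp_of (g : Mer n) (x : Cn n) (f : MerGerm x) :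
    mulOp g (DirectSum.of (fun x : Cn n => MerGerm x) x f) =
      DirectSum.of (fun x : Cn n => MerGerm x) x (germMer x g * f) := by
  have := DirectSum.lmap_lof (R := ℂ) (fun x => LinearMap.mulLeft ℂ (germMer (n := n) x g)) x f
  exact this

open Classical in
/-- Endomorphisms of `𝔐` are determined by their values on single germs. -/
theorem merGerms_end_ext {A B : Module.End ℂ (MerGerms n)}
    (h : ∀ x (f : MerGerm x), A (DirectSum.of (fun x : Cn n => MerGerm x) x f) =
      B (DirectSum.of (fun x : Cn n => MerGerm x) x f)) (F : MerGerms n) : A F = B F := by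
  induction F using DirectSum.induction_on with
  | zero => rw [A.map_zero, B.map_zero]
  | of x f => exact h x f
  | add a b ha hb => rw [A.map_add, B.map_add, ha, hb]

theorem pushOp_mul (e e' : Cn n ≃ᵃ[ℂ] Cn n) (F : MerGerms n) :
    pushOp (e * e') F = pushOp e (pushOp e' F) := by
  refine merGerms_end_ext (B := pushOp e * pushOp e') (fun x f => ?_) F
  rw [Module.End.mul_apply, pushOp_of, pushOp_of, pushOp_of, pushMerGerm_mul]
  rfl

theorem pushOp_one (F : MerGerms n) : pushOp (1 : Cn n ≃ᵃ[ℂ] Cn n) F = F := by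
  refine merGerms_end_ext (B := 1) (fun x f => ?_) F
  rw [pushOp_of, pushMerGerm_one]
  rfl

theorem pushOp_mulOp (e : Cn n ≃ᵃ[ℂ] Cn n) (f : Mer n) (F : MerGerms n) :
    pushOp e (mulOp f F) = mulOp (pushMer e f) (pushOp e F) := by
  refine merGerms_end_ext (A := pushOp e * mulOp f) (B := mulOp (pushMer e f) * pushOp e)
    (fun x g => ?_) F
  rw [Module.End.mul_apply, Module.End.mul_apply, mulOp_of, pushOp_of, pushOp_of, mulOp_of,
    germMer_pushMer]
  exact congrArg _ ((pushMerGerm e x).map_mul' _ g)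

theorem mulOp_mul (f g : Mer n) (F : MerGerms n) : mulOp (f * g) F = mulOp f (mulOp g F) := by
  refine merGerms_end_ext (B := mulOp f * mulOp g) (fun x h => ?_) F
  rw [Module.End.mul_apply, mulOp_of, mulOp_of, mulOp_of, RingHom.map_mul, mul_assoc]

theorem mulOp_add (f g : Mer n) (F : MerGerms n) : mulOp (f + g) F = mulOp f F + mulOp g F := by
  refine merGerms_end_ext (B := mulOp f + mulOp g) (fun x h => ?_) F
  rw [LinearMap.add_apply, mulOp_of, mulOp_of, mulOp_of, RingHom.map_add, add_mul]
  exact (DirectSum.lof ℂ (Cn n) (fun x : Cn n => MerGerm x) x).map_add _ _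

theorem mulOp_one (F : MerGerms n) : mulOp (n := n) 1 F = F := by
  refine merGerms_end_ext (B := 1) (fun x h => ?_) F
  rw [mulOp_of, RingHom.map_one, one_mul]
  rfl

theorem mulOp_zero (F : MerGerms n) : mulOp (n := n) 0 F = 0 := by
  have h := mulOp_add (n := n) 0 0 F
  rwa [add_zero, left_eq_add] at h

theorem mulOp_algebraMap (c : ℂ) (F : MerGerms n) :
    mulOp (algebraMap ℂ (Mer n) c) F = c • F := by
  refine merGerms_end_ext (B := c • (1 : Module.End ℂ (MerGerms n))) (fun x h => ?_) F
  rw [mulOp_of, IsScalarTower.algebraMap_apply ℂ (Hol n) (Mer n), germMer_algebraMap]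
  have : germHol x (algebraMap ℂ (Hol n) c) = algebraMap ℂ (HolGerm x) c := by
    refine Subtype.ext ?_
    change ((fun _ => c : Cn n → ℂ) : Germ (𝓝 x) ℂ) =
      ((c • (1 : Cn n → ℂ) : Cn n → ℂ) : Germ _ _)
    congr 1
    funext y
    simp
  rw [this, ← IsScalarTower.algebraMap_apply, ← Algebra.smul_def]
  exact (DirectSum.lof ℂ (Cn n) (fun x : Cn n => MerGerm x) x).map_smul c h

/-- The action of `g ∈ GL(V)` on meromorphic functions is multiplicative in `g`. -/
theorem pushMer_linear_mul (g h : Cn n ≃ₗ[ℂ] Cn n) (f : Mer n) :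
    pushMer (g * h).toAffineEquiv f = pushMer g.toAffineEquiv (pushMer h.toAffineEquiv f) := by
  rw [← pushMer_mul]; rfl

theorem pushMer_linear_one (f : Mer n) :
    pushMer (1 : Cn n ≃ₗ[ℂ] Cn n).toAffineEquiv f = f := pushMer_one f

theorem pushOp_linear_mul (g h : Cn n ≃ₗ[ℂ] Cn n) (F : MerGerms n) :
    pushOp (g * h).toAffineEquiv F = pushOp g.toAffineEquiv (pushOp h.toAffineEquiv F) := by
  rw [← pushOp_mul]; rfl

theorem pushOp_linear_one (F : MerGerms n) :
    pushOp (1 : Cn n ≃ₗ[ℂ] Cn n).toAffineEquiv F = F := pushOp_one F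

/-- A linear automorphism `g` conjugates the translation by `ξ` to the translation by `g ξ`. -/
theorem pushOp_translation (g : Cn n ≃ₗ[ℂ] Cn n) (ξ : Cn n) (F : MerGerms n) :
    pushOp (translation (g ξ)) (pushOp g.toAffineEquiv F) =
      pushOp g.toAffineEquiv (pushOp (translation ξ) F) := by
  rw [← pushOp_mul, ← pushOp_mul]
  congr 2
  ext x : 1
  change g ξ + g x = g (ξ + x)
  rw [map_add]

theorem Skew.op_single (ξ : Cn n) (f : Mer n) (F : MerGerms n) :
    Skew.op (Finsupp.single ξ f) F = mulOp f (pushOp (translation ξ) F) := by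
  rw [Skew.op, Finsupp.sum_single_index]
  · rfl
  · ext1 x; ext1 y; simp [mulOp_zero]

theorem Skew.op_sum {ι : Type*} (s : Finset ι) (X : ι → Skew n) (F : MerGerms n) :
    Skew.op (∑ i ∈ s, X i) F = ∑ i ∈ s, Skew.op (X i) F := by
  classical
  have hadd : ∀ X Y : Skew n, Skew.op (X + Y) F = Skew.op X F + Skew.op Y F := by
    intro X Y
    rw [Skew.op, Finsupp.sum_add_index']
    · rfl
    · intro ξ; ext1 x; ext1 y; simp [mulOp_zero]
    · intro ξ f g; refine LinearMap.ext fun H => ?_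
      exact mulOp_add f g _
  induction s using Finset.induction_on with
  | empty => simp [Skew.op]
  | insert a s ha ih => rw [Finset.sum_insert ha, Finset.sum_insert ha, hadd, ih]

theorem Skew.act_single (g : Cn n ≃ₗ[ℂ] Cn n) (ξ : Cn n) (f : Mer n) :
    Skew.act g (Finsupp.single ξ f) =
      Finsupp.single (g ξ) (pushMer g.toAffineEquiv f) := by
  rw [Skew.act, Finsupp.sum_single_index]
  simp

end Operators

/-! ### The action of the reflection group on real roots -/

namespace RootSys

variable (R : RootSys n)

theorem refl_mul_self (x : Fin n → ℝ) : R.refl x * R.refl x = 1 :=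
  LinearEquiv.ext fun y => (R.refl x).left_inv y

theorem refl_inv (x : Fin n → ℝ) : (R.refl x)⁻¹ = R.refl x :=
  inv_eq_of_mul_eq_one_left (R.refl_mul_self x)

theorem refl_mul_refl_mul (x : Fin n → ℝ) (g : Cn n ≃ₗ[ℂ] Cn n) :
    R.refl x * (R.refl x * g) = g := by
  rw [← mul_assoc, refl_mul_self, one_mul]

theorem refl_mem_group {x : Fin n → ℝ} (hx : x ∈ R.roots) : R.refl x ∈ R.group :=
  Subgroup.subset_closure ⟨x, hx, rfl⟩

/-- Every element of a group generated by reflections is a product of the generators, no inverses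
being needed. -/
theorem exists_word {S : Set (Fin n → ℝ)} {g : Cn n ≃ₗ[ℂ] Cn n}
    (hg : g ∈ Subgroup.closure (R.refl '' S)) :
    ∃ l : List (Fin n → ℝ), (∀ x ∈ l, x ∈ S) ∧ (l.map R.refl).prod = g := by
  induction hg using Subgroup.closure_induction_left with
  | one => exact ⟨[], by simp, by simp⟩
  | mul_left x hx y hy ih =>
    obtain ⟨x, hx, rfl⟩ := hx
    obtain ⟨l, hl, rfl⟩ := ih
    exact ⟨x :: l, by simpa using ⟨hx, hl⟩, by simp⟩
  | inv_mul_cancel x hx y hy ih =>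
    obtain ⟨x, hx, rfl⟩ := hx
    obtain ⟨l, hl, rfl⟩ := ih
    exact ⟨x :: l, by simpa using ⟨hx, hl⟩, by simp [refl_inv]⟩

theorem closure_refl_induction {S : Set (Fin n → ℝ)} {p : (Cn n ≃ₗ[ℂ] Cn n) → Prop} (h1 : p 1)
    (hmul : ∀ x ∈ S, ∀ g ∈ Subgroup.closure (R.refl '' S), p g → p (R.refl x * g))
    {g : Cn n ≃ₗ[ℂ] Cn n} (hg : g ∈ Subgroup.closure (R.refl '' S)) : p g := by
  obtain ⟨l, hl, rfl⟩ := R.exists_word hg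
  clear hg
  have : ∀ l : List (Fin n → ℝ), (∀ x ∈ l, x ∈ S) →
      (l.map R.refl).prod ∈ Subgroup.closure (R.refl '' S) ∧ p (l.map R.refl).prod := by
    intro l
    induction l with
    | nil => exact fun _ => ⟨Subgroup.one_mem _, h1⟩
    | cons x l ih =>
      intro h
      have hx := h x (by simp)
      obtain ⟨h2, h3⟩ := ih fun y hy => h y (by simp [hy])
      rw [List.map_cons, List.prod_cons]
      exact ⟨Subgroup.mul_mem _ (Subgroup.subset_closure ⟨x, hx, rfl⟩) h2, hmul x hx _ h2 h3⟩
  exact (this l hl).2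

/-- The action of `g ∈ GL(V)` on real vectors. For `g` in the reflection group, `g` maps real
vectors to real vectors, so taking real parts loses nothing. -/
def ract (g : Cn n ≃ₗ[ℂ] Cn n) (x : Fin n → ℝ) : Fin n → ℝ := fun i => (g (toCn x) i).re

variable {R} {g h : Cn n ≃ₗ[ℂ] Cn n}

theorem ract_eq_of_toCn {x y : Fin n → ℝ} (hxy : g (toCn x) = toCn y) : ract g x = y := by
  funext i
  rw [ract, hxy]
  simp [toCn]

theorem toCn_ract (hg : g ∈ R.group) (x : Fin n → ℝ) : toCn (ract g x) = g (toCn x) := by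
  have : ∃ y, g (toCn x) = toCn y := by
    refine R.closure_refl_induction (p := fun g => ∃ y, g (toCn x) = toCn y) ⟨x, rfl⟩ ?_ hg
    rintro z hz g - ⟨y, hy⟩
    exact ⟨R.realRefl z y, by rw [LinearEquiv.mul_apply, hy, refl_toCn]⟩
  obtain ⟨y, hy⟩ := this
  rw [ract_eq_of_toCn hy, hy]

theorem ract_refl (x y : Fin n → ℝ) : ract (R.refl x) y = R.realRefl x y :=
  ract_eq_of_toCn (R.refl_toCn x y)

theorem ract_one (x : Fin n → ℝ) : ract (1 : Cn n ≃ₗ[ℂ] Cn n) x = x := ract_eq_of_toCn rfl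

theorem ract_mul (hh : h ∈ R.group) (x : Fin n → ℝ) : ract (g * h) x = ract g (ract h x) := by
  funext i
  rw [ract, ract, toCn_ract hh, LinearEquiv.mul_apply]

theorem ract_inv_ract (hg : g ∈ R.group) (x : Fin n → ℝ) : ract g⁻¹ (ract g x) = x := by
  rw [← ract_mul hg, inv_mul_cancel, ract_one]

theorem ract_ract_inv (hg : g ∈ R.group) (x : Fin n → ℝ) : ract g (ract g⁻¹ x) = x := by
  rw [← ract_mul (R.group.inv_mem hg), mul_inv_cancel, ract_one]

theorem ract_add (g : Cn n ≃ₗ[ℂ] Cn n) (x y : Fin n → ℝ) :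
    ract g (x + y) = ract g x + ract g y := by
  have : toCn (x + y) = toCn x + toCn y := by funext i; simp [toCn]
  funext i
  simp [ract, this]

theorem ract_smul (g : Cn n ≃ₗ[ℂ] Cn n) (c : ℝ) (x : Fin n → ℝ) :
    ract g (c • x) = c • ract g x := by
  have : toCn (c • x) = (c : ℂ) • toCn x := by funext i; simp [toCn]
  funext i
  simp only [ract, this, map_smul, Pi.smul_apply, smul_eq_mul, Complex.re_ofReal_mul]

/-- The action of `g ∈ GL(V)` on real vectors as a linear map. -/
def ractLin (g : Cn n ≃ₗ[ℂ] Cn n) : (Fin n → ℝ) →ₗ[ℝ] (Fin n → ℝ) where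
  toFun := ract g
  map_add' := ract_add g
  map_smul' := ract_smul g

theorem ract_neg (g : Cn n ≃ₗ[ℂ] Cn n) (x : Fin n → ℝ) : ract g (-x) = -ract g x :=
  (ractLin g).map_neg x

theorem ract_mem_roots (hg : g ∈ R.group) {x : Fin n → ℝ} (hx : x ∈ R.roots) :
    ract g x ∈ R.roots := by
  obtain ⟨y, hy, h1, -⟩ := (R.group_permutes hg).1 x hx
  rwa [ract_eq_of_toCn h1]

theorem gammaLin_ract (hg : g ∈ R.group) (x : Fin n → ℝ) (y : Cn n) :
    R.gammaLin (ract g x) (g y) = R.gammaLin x y := by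
  refine R.closure_refl_induction
    (p := fun g => ∀ x y, R.gammaLin (ract g x) (g y) = R.gammaLin x y) ?_ ?_ hg x y
  · intro x y; rw [ract_one]; rfl
  · intro z hz g hg ih x y
    rw [ract_mul hg, ract_refl, LinearEquiv.mul_apply, gammaLin_refl _ (R.anisotropic z hz), ih]

theorem form_ract (hg : g ∈ R.group) (x y : Fin n → ℝ) :
    R.form (ract g x) (ract g y) = R.form x y := by
  have := gammaLin_ract hg x (toCn y)
  rw [← toCn_ract hg, gammaLin_toCn, gammaLin_toCn] at this
  exact_mod_cast this

/-- Conjugating a reflection by `g` gives the reflection in the transformed vector. -/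
theorem refl_ract (hg : g ∈ R.group) (x : Fin n → ℝ) :
    R.refl (ract g x) = g * R.refl x * g⁻¹ := by
  rw [eq_mul_inv_iff_mul_eq]
  refine LinearEquiv.ext fun y => ?_
  rw [LinearEquiv.mul_apply, LinearEquiv.mul_apply, refl_apply, refl_apply, gammaLin_ract hg,
    form_ract hg, toCn_ract hg, map_sub, map_smul]

theorem gammaLin_neg (x : Fin n → ℝ) (y : Cn n) : R.gammaLin (-x) y = -R.gammaLin x y := by
  simp [gammaLin]

theorem refl_neg (x : Fin n → ℝ) : R.refl (-x) = R.refl x := by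
  refine LinearEquiv.ext fun y => ?_
  have : toCn (-x) = -toCn x := by funext i; simp [toCn]
  rw [refl_apply, refl_apply, gammaLin_neg, this]
  simp

theorem realRefl_self {x : Fin n → ℝ} (hx : x ∈ R.roots) : R.realRefl x x = -x := by
  have := R.anisotropic x hx
  rw [realRefl, mul_div_assoc, div_self this, mul_one, two_smul]
  abel

theorem ract_refl_self {x : Fin n → ℝ} (hx : x ∈ R.roots) : ract (R.refl x) x = -x := by
  rw [ract_refl, realRefl_self hx]

theorem neg_mem_roots {x : Fin n → ℝ} (hx : x ∈ R.roots) : -x ∈ R.roots := by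
  rw [← realRefl_self hx]
  exact R.realRefl_mem hx hx

theorem ne_zero_of_mem_roots {x : Fin n → ℝ} (hx : x ∈ R.roots) : x ≠ 0 := by
  rintro rfl
  exact R.anisotropic 0 hx (by simp)

/-! ### Coordinates with respect to the simple roots and positivity -/

variable {Ψ : Finset (Fin n → ℝ)}

/-- Linear functionals can be prescribed on the simple roots. -/
theorem IsBase.exists_functional (hΨ : R.IsBase Ψ) (c : (Fin n → ℝ) → ℝ) :
    ∃ f : (Fin n → ℝ) →ₗ[ℝ] ℝ, ∀ x ∈ Ψ, f x = c x := by
  have hli : LinearIndepOn ℝ id (Ψ : Set (Fin n → ℝ)) := hΨ.2.1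
  let b := Module.Basis.extend hli
  refine ⟨b.constr ℝ (fun i => c i), fun x hx => ?_⟩
  have hx' : x ∈ hli.extend (Set.subset_univ _) := hli.subset_extend _ hx
  have hb : b ⟨x, hx'⟩ = x := by simp [b]
  conv_lhs => rw [← hb]
  rw [Module.Basis.constr_basis]

open Classical in
/-- The functional that reads off the coordinate at a simple root `z`, extended in some way to
all of `ℝⁿ`. -/
def IsBase.coord (hΨ : R.IsBase Ψ) (z : Fin n → ℝ) : (Fin n → ℝ) →ₗ[ℝ] ℝ :=
  (hΨ.exists_functional (fun x => if x = z then 1 else 0)).choose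

variable (hΨ : R.IsBase Ψ)

open Classical in
theorem IsBase.coord_apply (z : Fin n → ℝ) {x : Fin n → ℝ} (hx : x ∈ Ψ) :
    hΨ.coord z x = if x = z then 1 else 0 :=
  (hΨ.exists_functional (fun x => if x = z then 1 else 0)).choose_spec x hx

theorem IsBase.coord_self {x : Fin n → ℝ} (hx : x ∈ Ψ) : hΨ.coord x x = 1 := by
  rw [hΨ.coord_apply x hx, if_pos rfl]

theorem IsBase.coord_of_ne {x z : Fin n → ℝ} (hx : x ∈ Ψ) (h : x ≠ z) : hΨ.coord z x = 0 := by
  rw [hΨ.coord_apply z hx, if_neg h]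

theorem mem_posRoots {x : Fin n → ℝ} : x ∈ R.posRoots Ψ ↔
    x ∈ R.roots ∧ x ∈ Submodule.span NNReal (Ψ : Set (Fin n → ℝ)) := by
  classical
  rw [posRoots, Finset.mem_filter]

theorem roots_of_posRoots {x : Fin n → ℝ} (hx : x ∈ R.posRoots Ψ) : x ∈ R.roots :=
  (mem_posRoots.1 hx).1

include hΨ

theorem IsBase.mem_posRoots {x : Fin n → ℝ} (hx : x ∈ Ψ) : x ∈ R.posRoots Ψ :=
  RootSys.mem_posRoots.2 ⟨hΨ.1 hx, Submodule.subset_span hx⟩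

theorem IsBase.pos_or_neg {x : Fin n → ℝ} (hx : x ∈ R.roots) :
    x ∈ R.posRoots Ψ ∨ -x ∈ R.posRoots Ψ := by
  rcases hΨ.2.2 x hx with h | h
  · exact Or.inl (RootSys.mem_posRoots.2 ⟨hx, h⟩)
  · exact Or.inr (RootSys.mem_posRoots.2 ⟨neg_mem_roots hx, h⟩)

theorem IsBase.sum_coord_of_mem_span {y : Fin n → ℝ}
    (hy : y ∈ Submodule.span NNReal (Ψ : Set (Fin n → ℝ))) :
    y = ∑ x ∈ Ψ, hΨ.coord x y • x := by
  induction hy using Submodule.span_induction with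
  | mem y hy =>
    rw [Finset.sum_eq_single_of_mem y hy, hΨ.coord_self hy, one_smul]
    intro z _ hz
    rw [hΨ.coord_of_ne hy hz.symm, zero_smul]
  | zero => simp
  | add a b _ _ ha hb =>
    simp only [map_add, add_smul, Finset.sum_add_distrib]
    rw [← ha, ← hb]
  | smul c a _ ha =>
    have : ∀ z, hΨ.coord z (c • a) = (c : ℝ) * hΨ.coord z a := fun z =>
      (hΨ.coord z).map_smul (c : ℝ) a
    simp only [this, mul_smul, ← Finset.smul_sum]
    rw [← ha]
    rfl

theorem IsBase.sum_coord {y : Fin n → ℝ} (hy : y ∈ R.roots) :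
    y = ∑ x ∈ Ψ, hΨ.coord x y • x := by
  rcases hΨ.2.2 y hy with h | h
  · exact hΨ.sum_coord_of_mem_span h
  · have := hΨ.sum_coord_of_mem_span h
    simp only [map_neg, neg_smul, Finset.sum_neg_distrib, neg_inj] at this
    exact this

theorem IsBase.coord_nonneg {y : Fin n → ℝ} (hy : y ∈ R.posRoots Ψ) (z : Fin n → ℝ) :
    0 ≤ hΨ.coord z y := by
  replace hy := (RootSys.mem_posRoots.1 hy).2
  induction hy using Submodule.span_induction with
  | mem y hy => rw [hΨ.coord_apply z hy]; split_ifs <;> norm_num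
  | zero => simp
  | add a b _ _ ha hb => rw [map_add]; exact add_nonneg ha hb
  | smul c a _ ha =>
    have : hΨ.coord z (c • a) = (c : ℝ) * hΨ.coord z a := (hΨ.coord z).map_smul (c : ℝ) a
    rw [this]
    exact mul_nonneg c.2 ha

theorem IsBase.exists_coord_ne_zero {y : Fin n → ℝ} (hy : y ∈ R.roots) :
    ∃ z ∈ Ψ, hΨ.coord z y ≠ 0 := by
  by_contra! h
  refine ne_zero_of_mem_roots hy ?_
  rw [hΨ.sum_coord hy]
  exact Finset.sum_eq_zero fun z hz => by rw [h z hz, zero_smul]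

theorem IsBase.neg_notMem_posRoots {y : Fin n → ℝ} (hy : y ∈ R.posRoots Ψ) :
    -y ∉ R.posRoots Ψ := by
  intro h
  obtain ⟨z, -, hz⟩ := hΨ.exists_coord_ne_zero (roots_of_posRoots hy)
  have h1 := hΨ.coord_nonneg hy z
  have h2 := hΨ.coord_nonneg h z
  rw [map_neg] at h2
  exact hz (by linarith)

theorem IsBase.pos_of_coord_pos {y z : Fin n → ℝ} (hy : y ∈ R.roots) (hz : 0 < hΨ.coord z y) :
    y ∈ R.posRoots Ψ := by
  rcases hΨ.pos_or_neg hy with h | h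
  · exact h
  · have := hΨ.coord_nonneg h z
    rw [map_neg] at this
    linarith

theorem IsBase.neg_pos_of_coord_nonpos {y : Fin n → ℝ} (hy : y ∈ R.roots)
    (h : ∀ z ∈ Ψ, hΨ.coord z y ≤ 0) : -y ∈ R.posRoots Ψ := by
  obtain ⟨z, hz, hz0⟩ := hΨ.exists_coord_ne_zero hy
  refine hΨ.pos_of_coord_pos (neg_mem_roots hy) (z := z) ?_
  rw [map_neg]
  have := lt_of_le_of_ne (h z hz) hz0
  linarith

theorem IsBase.coord_realRefl {x z : Fin n → ℝ} (hx : x ∈ Ψ) (hxz : x ≠ z) (y : Fin n → ℝ) :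
    hΨ.coord z (R.realRefl x y) = hΨ.coord z y := by
  rw [realRefl, map_sub, map_smul, hΨ.coord_of_ne hx hxz, smul_zero, sub_zero]

/-- A simple reflection permutes the positive roots other than its own root. -/
theorem IsBase.realRefl_pos {x y : Fin n → ℝ} (hx : x ∈ Ψ) (hy : y ∈ R.posRoots Ψ)
    (hyx : y ≠ x) : R.realRefl x y ∈ R.posRoots Ψ := by
  have hyR := roots_of_posRoots hy
  have : ∃ z ∈ Ψ, x ≠ z ∧ hΨ.coord z y ≠ 0 := by
    by_contra! h
    have hs := hΨ.sum_coord hyR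
    rw [Finset.sum_eq_single_of_mem x hx
      (fun z hz hzx => by rw [h z hz hzx.symm, zero_smul])] at hs
    rcases R.reduced x (hΨ.1 hx) (hΨ.coord x y) (hs ▸ hyR) with h1 | h1
    · rw [h1, one_smul] at hs
      exact hyx hs
    · have := hΨ.coord_nonneg hy x
      linarith
  obtain ⟨z, hz, hxz, h0⟩ := this
  refine hΨ.pos_of_coord_pos (R.realRefl_mem (hΨ.1 hx) hyR) (z := z) ?_
  rw [hΨ.coord_realRefl hx hxz]
  exact lt_of_le_of_ne (hΨ.coord_nonneg hy z) h0.symm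

omit hΨ

/-! ### Inversions -/

variable (R Ψ) in
open Classical in
/-- The positive roots that `g` makes negative. -/
def inversions (g : Cn n ≃ₗ[ℂ] Cn n) : Finset (Fin n → ℝ) :=
  (R.posRoots Ψ).filter (fun y => -ract g y ∈ R.posRoots Ψ)

theorem mem_inversions {y : Fin n → ℝ} : y ∈ R.inversions Ψ g ↔
    y ∈ R.posRoots Ψ ∧ -ract g y ∈ R.posRoots Ψ := by
  classical
  rw [inversions, Finset.mem_filter]

include hΨ

theorem IsBase.group_of_simple {x : Fin n → ℝ} (hx : x ∈ Ψ) : R.refl x ∈ R.group :=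
  R.refl_mem_group (hΨ.1 hx)

theorem IsBase.closure_le_group {S : Set (Fin n → ℝ)} (hS : S ⊆ Ψ) :
    Subgroup.closure (R.refl '' S) ≤ R.group :=
  Subgroup.closure_mono (Set.image_mono (hS.trans hΨ.1))

theorem IsBase.word_mem_group {l : List (Fin n → ℝ)} (hl : ∀ x ∈ l, x ∈ Ψ) :
    (l.map R.refl).prod ∈ R.group := by
  refine Subgroup.list_prod_mem _ fun x hx => ?_
  obtain ⟨y, hy, rfl⟩ := List.mem_map.1 hx
  exact hΨ.group_of_simple (hl y hy)

theorem IsBase.card_inversions_refl_mul_le (hg : g ∈ R.group) {x : Fin n → ℝ} (hx : x ∈ Ψ) :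
    (R.inversions Ψ (R.refl x * g)).card ≤ (R.inversions Ψ g).card + 1 := by
  classical
  have hsub : R.inversions Ψ (R.refl x * g) ⊆ insert (ract g⁻¹ x) (R.inversions Ψ g) := by
    intro y hy
    rw [mem_inversions, ract_mul hg, ract_refl] at hy
    rw [Finset.mem_insert, mem_inversions]
    by_cases h : y = ract g⁻¹ x
    · exact Or.inl h
    refine Or.inr ⟨hy.1, ?_⟩
    refine (hΨ.pos_or_neg (ract_mem_roots hg (roots_of_posRoots hy.1))).resolve_left fun h' => ?_
    have hne : ract g y ≠ x := fun h2 => h (by rw [← h2, ract_inv_ract hg])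
    exact hΨ.neg_notMem_posRoots (hΨ.realRefl_pos hx h' hne) hy.2
  exact (Finset.card_le_card hsub).trans (Finset.card_insert_le _ _)

/-- The number of inversions is at most the length of any expression. -/
theorem IsBase.card_inversions_le_length {l : List (Fin n → ℝ)} (hl : ∀ x ∈ l, x ∈ Ψ) :
    (R.inversions Ψ (l.map R.refl).prod).card ≤ l.length := by
  induction l with
  | nil =>
    rw [List.map_nil, List.prod_nil, List.length_nil, Nat.le_zero, Finset.card_eq_zero,
      Finset.eq_empty_iff_forall_notMem]
    intro y hy
    rw [mem_inversions, ract_one] at hy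
    exact hΨ.neg_notMem_posRoots hy.1 hy.2
  | cons x l ih =>
    have hl' : ∀ y ∈ l, y ∈ Ψ := fun y hy => hl y (by simp [hy])
    rw [List.map_cons, List.prod_cons, List.length_cons]
    exact (hΨ.card_inversions_refl_mul_le (hΨ.word_mem_group hl') (hl x (by simp))).trans
      (Nat.add_le_add_right (ih hl') 1)

theorem IsBase.card_inversions_lt_mul_refl {x : Fin n → ℝ} (hx : x ∈ Ψ)
    (hpos : ract g x ∈ R.posRoots Ψ) :
    (R.inversions Ψ g).card < (R.inversions Ψ (g * R.refl x)).card := by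
  classical
  have hxR := hΨ.1 hx
  have hxnot : x ∉ R.inversions Ψ g := fun h =>
    hΨ.neg_notMem_posRoots hpos (mem_inversions.1 h).2
  have hsub : insert x ((R.inversions Ψ g).image (R.realRefl x)) ⊆
      R.inversions Ψ (g * R.refl x) := by
    intro y hy
    rw [mem_inversions, ract_mul (hΨ.group_of_simple hx), ract_refl]
    rcases Finset.mem_insert.1 hy with rfl | hy
    · exact ⟨hΨ.mem_posRoots hx, by rwa [realRefl_self hxR, ract_neg, neg_neg]⟩
    · obtain ⟨z, hz, rfl⟩ := Finset.mem_image.1 hy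
      have hz' := mem_inversions.1 hz
      refine ⟨hΨ.realRefl_pos hx hz'.1 ?_, ?_⟩
      · rintro rfl; exact hxnot hz
      · rw [R.realRefl_realRefl (R.anisotropic x hxR)]; exact hz'.2
  have hnot : x ∉ (R.inversions Ψ g).image (R.realRefl x) := by
    intro h
    obtain ⟨z, hz, hzx⟩ := Finset.mem_image.1 h
    have hz' := mem_inversions.1 hz
    have : z = -x := by
      rw [← R.realRefl_realRefl (R.anisotropic x hxR) z, hzx, realRefl_self hxR]
    exact hΨ.neg_notMem_posRoots (hΨ.mem_posRoots hx) (this ▸ hz'.1)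
  have hcard := Finset.card_le_card hsub
  rw [Finset.card_insert_of_notMem hnot, Finset.card_image_of_injective] at hcard
  · omega
  · exact Function.LeftInverse.injective (R.realRefl_realRefl (R.anisotropic x hxR))

/-- If a word in the simple reflections makes the positive root `y` negative, then `y` becomes
simple on the way: just before the sign changes, it is the root of the next letter. -/
theorem IsBase.exists_letter {l : List (Fin n → ℝ)} (hl : ∀ x ∈ l, x ∈ Ψ) {y : Fin n → ℝ}
    (hy : y ∈ R.posRoots Ψ) (hneg : -ract (l.map R.refl).prod y ∈ R.posRoots Ψ) :
    ∃ l₁ x l₂, l = l₁ ++ x :: l₂ ∧ ract (l₂.map R.refl).prod y = x := by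
  induction l with
  | nil =>
    rw [List.map_nil, List.prod_nil, ract_one] at hneg
    exact absurd hneg (hΨ.neg_notMem_posRoots hy)
  | cons x l ih =>
    have hl' : ∀ y ∈ l, y ∈ Ψ := fun y hy => hl y (by simp [hy])
    have hw := hΨ.word_mem_group hl'
    rcases hΨ.pos_or_neg (ract_mem_roots hw (roots_of_posRoots hy)) with h | h
    · refine ⟨[], x, l, rfl, ?_⟩
      by_contra hne
      rw [List.map_cons, List.prod_cons, ract_mul hw, ract_refl] at hneg
      exact hΨ.neg_notMem_posRoots (hΨ.realRefl_pos (hl x (by simp)) h hne) hneg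
    · obtain ⟨l₁, z, l₂, rfl, h2⟩ := ih hl' h
      exact ⟨x :: l₁, z, l₂, rfl, h2⟩

/-- The exchange condition. -/
theorem IsBase.exchange {l : List (Fin n → ℝ)} (hl : ∀ x ∈ l, x ∈ Ψ) {y : Fin n → ℝ}
    (hy : y ∈ R.posRoots Ψ) (hneg : -ract (l.map R.refl).prod y ∈ R.posRoots Ψ) :
    ∃ l' : List (Fin n → ℝ), (∀ x ∈ l', x ∈ Ψ) ∧ l'.length + 1 = l.length ∧
      (l'.map R.refl).prod = (l.map R.refl).prod * R.refl y := by
  obtain ⟨l₁, x, l₂, rfl, hx⟩ := hΨ.exists_letter hl hy hneg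
  have hl₂ : ∀ y ∈ l₂, y ∈ Ψ := fun y hy => hl y (by simp [hy])
  refine ⟨l₁ ++ l₂, ?_, by simp; omega, ?_⟩
  · intro z hz
    rcases List.mem_append.1 hz with hz | hz
    · exact hl z (by simp [hz])
    · exact hl₂ z hz
  · have h1 := refl_ract (R := R) (hΨ.word_mem_group hl₂) y
    rw [hx, eq_mul_inv_iff_mul_eq] at h1
    simp only [List.map_append, List.map_cons, List.prod_append, List.prod_cons]
    rw [mul_assoc, mul_assoc, ← h1, refl_mul_refl_mul]

end RootSys

namespace RootSys

variable {R : RootSys n} {g h : Cn n ≃ₗ[ℂ] Cn n} {Ψ : Finset (Fin n → ℝ)}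

/-! ### Parabolic subgroups and their longest elements -/

variable (R Ψ) in
/-- The simple roots whose reflections lie in `K`. -/
def simples (K : Subgroup (Cn n ≃ₗ[ℂ] Cn n)) : Set (Fin n → ℝ) := {x | x ∈ Ψ ∧ R.refl x ∈ K}

theorem IsParabolic.eq_closure {K : Subgroup (Cn n ≃ₗ[ℂ] Cn n)} (hK : R.IsParabolic Ψ K) :
    K = Subgroup.closure (R.refl '' R.simples Ψ K) := by
  obtain ⟨J, hJ, hKJ⟩ := hK
  refine le_antisymm ?_ ?_
  · conv_lhs => rw [hKJ]
    refine Subgroup.closure_mono (Set.image_mono fun x hx => ⟨hJ hx, ?_⟩)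
    rw [hKJ]
    exact Subgroup.subset_closure ⟨x, hx, rfl⟩
  · rw [Subgroup.closure_le]
    rintro _ ⟨x, hx, rfl⟩
    exact hx.2

theorem IsParabolic.of_eq_closure {S : Set (Fin n → ℝ)} (hS : S ⊆ Ψ) :
    R.IsParabolic Ψ (Subgroup.closure (R.refl '' S)) := by
  classical
  refine ⟨Ψ.filter (· ∈ S), Finset.filter_subset _ _, ?_⟩
  congr 2
  ext x
  simpa using fun hx => hS hx

theorem IsParabolic.induction {K : Subgroup (Cn n ≃ₗ[ℂ] Cn n)} (hK : R.IsParabolic Ψ K)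
    {p : (Cn n ≃ₗ[ℂ] Cn n) → Prop} (h1 : p 1)
    (hmul : ∀ x ∈ R.simples Ψ K, ∀ g ∈ K, p g → p (R.refl x * g))
    {g : Cn n ≃ₗ[ℂ] Cn n} (hg : g ∈ K) : p g := by
  have hg' : g ∈ Subgroup.closure (R.refl '' R.simples Ψ K) := by rwa [← hK.eq_closure]
  refine R.closure_refl_induction h1 (fun x hx g hg hp => hmul x hx g ?_ hp) hg'
  rwa [hK.eq_closure]

variable (hΨ : R.IsBase Ψ)

include hΨ

theorem IsParabolic.le_group {K : Subgroup (Cn n ≃ₗ[ℂ] Cn n)} (hK : R.IsParabolic Ψ K) :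
    K ≤ R.group := by
  rw [hK.eq_closure]
  exact hΨ.closure_le_group fun x hx => hx.1

/-- A parabolic subgroup changes only the coordinates at its own simple roots. -/
theorem IsBase.coord_ract {K : Subgroup (Cn n ≃ₗ[ℂ] Cn n)} (hK : R.IsParabolic Ψ K)
    (hg : g ∈ K) {z : Fin n → ℝ} (hz : z ∉ R.simples Ψ K) (y : Fin n → ℝ) :
    hΨ.coord z (ract g y) = hΨ.coord z y := by
  refine hK.induction (p := fun g => hΨ.coord z (ract g y) = hΨ.coord z y) (by rw [ract_one]) ?_ hg
  intro x hx g hg ih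
  rw [ract_mul (hK.le_group hΨ hg), ract_refl, hΨ.coord_realRefl hx.1, ih]
  rintro rfl
  exact hz hx

/-- The roots of a parabolic subgroup are combinations of its simple roots. -/
theorem IsBase.coord_eq_zero {K : Subgroup (Cn n ≃ₗ[ℂ] Cn n)} (hK : R.IsParabolic Ψ K)
    {y z : Fin n → ℝ} (hy : y ∈ R.roots) (hyK : R.refl y ∈ K) (hz : z ∉ R.simples Ψ K) :
    hΨ.coord z y = 0 := by
  have := hΨ.coord_ract hK hyK hz y
  rw [ract_refl_self hy, map_neg] at this
  linarith

/-- A parabolic subgroup contains an element that makes all its simple roots negative. -/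
theorem IsBase.exists_neg_simples {K : Subgroup (Cn n ≃ₗ[ℂ] Cn n)} (hK : R.IsParabolic Ψ K) :
    ∃ w ∈ K, ∀ x ∈ R.simples Ψ K, -ract w x ∈ R.posRoots Ψ := by
  classical
  -- An element of `K` with as many inversions as possible.
  have hbdd : BddAbove {k | ∃ w ∈ K, (R.inversions Ψ w).card = k} := by
    refine ⟨(R.posRoots Ψ).card, ?_⟩
    rintro _ ⟨w, -, rfl⟩
    exact Finset.card_le_card (Finset.filter_subset _ _)
  obtain ⟨w, hw, hmax⟩ := Nat.sSup_mem (⟨_, 1, K.one_mem, rfl⟩ : Set.Nonempty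
    {k | ∃ w ∈ K, (R.inversions Ψ w).card = k}) hbdd
  refine ⟨w, hw, fun x hx => ?_⟩
  refine (hΨ.pos_or_neg (ract_mem_roots (hK.le_group hΨ hw) (hΨ.1 hx.1))).resolve_left fun h => ?_
  have h1 := hΨ.card_inversions_lt_mul_refl hx.1 h
  have h2 := le_csSup hbdd ⟨w * R.refl x, K.mul_mem hw hx.2, rfl⟩
  rw [← hmax] at h2
  exact absurd h1 (not_lt.2 h2)

/-- An element that makes all simple roots of `K` negative makes all positive combinations of
them negative. -/
theorem IsBase.neg_of_neg_simples {K : Subgroup (Cn n ≃ₗ[ℂ] Cn n)} (hw : g ∈ R.group)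
    (hneg : ∀ x ∈ R.simples Ψ K, -ract g x ∈ R.posRoots Ψ) {y : Fin n → ℝ}
    (hy : y ∈ R.posRoots Ψ) (hyK : ∀ z ∈ Ψ, z ∉ R.simples Ψ K → hΨ.coord z y = 0) :
    -ract g y ∈ R.posRoots Ψ := by
  refine hΨ.neg_pos_of_coord_nonpos (ract_mem_roots hw (roots_of_posRoots hy)) fun z hz => ?_
  have h1 : ract g y = ∑ x ∈ Ψ, hΨ.coord x y • ract g x := by
    conv_lhs => rw [hΨ.sum_coord (roots_of_posRoots hy)]
    exact (map_sum (ractLin g) _ _).trans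
      (Finset.sum_congr rfl fun x _ => (ractLin g).map_smul _ _)
  rw [h1, map_sum]
  refine Finset.sum_nonpos fun x hx => ?_
  rw [map_smul, smul_eq_mul]
  by_cases hxK : x ∈ R.simples Ψ K
  · have := hΨ.coord_nonneg (hneg x hxK) z
    rw [map_neg] at this
    exact mul_nonpos_of_nonneg_of_nonpos (hΨ.coord_nonneg hy x) (by linarith)
  · rw [hyK x hx hxK, zero_mul]

/-- The reflection group is generated by the simple reflections: an element that makes all positive
roots negative carries every positive root through a simple one. -/
theorem IsBase.isParabolic_group : R.IsParabolic Ψ R.group := by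
  set K := Subgroup.closure (R.refl '' (Ψ : Set (Fin n → ℝ))) with hKdef
  have hK : R.IsParabolic Ψ K := ⟨Ψ, subset_rfl, rfl⟩
  have hsimp : ∀ z ∈ Ψ, z ∈ R.simples Ψ K := fun z hz =>
    ⟨hz, Subgroup.subset_closure ⟨z, hz, rfl⟩⟩
  obtain ⟨w, hw, hneg⟩ := hΨ.exists_neg_simples hK
  obtain ⟨l, hl, rfl⟩ := R.exists_word hw
  have hpos : ∀ y ∈ R.posRoots Ψ, R.refl y ∈ K := by
    intro y hy
    obtain ⟨l₁, x, l₂, rfl, hx⟩ := hΨ.exists_letter hl hy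
      (hΨ.neg_of_neg_simples (hK.le_group hΨ hw) hneg hy fun z hz h => absurd (hsimp z hz) h)
    have hl₂ : (l₂.map R.refl).prod ∈ K := by
      refine Subgroup.list_prod_mem _ fun g hg => ?_
      obtain ⟨z, hz, rfl⟩ := List.mem_map.1 hg
      exact (hsimp z (hl z (by simp [hz]))).2
    have h1 := refl_ract (hK.le_group hΨ hl₂) y
    rw [hx] at h1
    have h2 : R.refl y = (l₂.map R.refl).prod⁻¹ * R.refl x * (l₂.map R.refl).prod := by
      rw [h1]; group
    rw [h2]
    exact K.mul_mem (K.mul_mem (K.inv_mem hl₂) (hsimp x (hl x (by simp))).2) hl₂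
  have hle : R.group ≤ K := by
    rw [group, Subgroup.closure_le]
    rintro _ ⟨y, hy, rfl⟩
    rcases hΨ.pos_or_neg hy with h | h
    · exact hpos y h
    · rw [← refl_neg]; exact hpos _ h
  exact (le_antisymm hle (hK.le_group hΨ)) ▸ hK

/-! ### Lengths and reduced expressions -/

theorem IsBase.exists_isExpr (hg : g ∈ R.group) : ∃ l, R.IsExpr Ψ g l := by
  have h := hΨ.isParabolic_group.eq_closure
  rw [h] at hg
  obtain ⟨l, hl, hlg⟩ := R.exists_word hg
  exact ⟨l, fun x hx => (hl x hx).1, hlg⟩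

theorem IsBase.exists_isReducedExpr (hg : g ∈ R.group) : ∃ l, R.IsReducedExpr Ψ g l := by
  obtain ⟨l, hl⟩ := hΨ.exists_isExpr hg
  obtain ⟨l', hl', h⟩ := Nat.sInf_mem
    (⟨_, l, hl, rfl⟩ : Set.Nonempty {k | ∃ l, R.IsExpr Ψ g l ∧ l.length = k})
  exact ⟨l', hl', h⟩

omit hΨ in
theorem IsExpr.len_le {l : List (Fin n → ℝ)} (hl : R.IsExpr Ψ g l) : R.len Ψ g ≤ l.length :=
  Nat.sInf_le ⟨l, hl, rfl⟩

theorem IsBase.card_inversions_le_len (hg : g ∈ R.group) :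
    (R.inversions Ψ g).card ≤ R.len Ψ g := by
  obtain ⟨l, ⟨hl, rfl⟩, h⟩ := hΨ.exists_isReducedExpr hg
  rw [← h]
  exact hΨ.card_inversions_le_length hl

omit hΨ in
theorem IsExpr.mul {l l' : List (Fin n → ℝ)} (hl : R.IsExpr Ψ g l) (hl' : R.IsExpr Ψ h l') :
    R.IsExpr Ψ (g * h) (l ++ l') := by
  refine ⟨fun x hx => ?_, by rw [List.map_append, List.prod_append, hl.2, hl'.2]⟩
  rcases List.mem_append.1 hx with hx | hx
  · exact hl.1 x hx
  · exact hl'.1 x hx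

theorem IsBase.len_mul_le (hg : g ∈ R.group) (hh : h ∈ R.group) :
    R.len Ψ (g * h) ≤ R.len Ψ g + R.len Ψ h := by
  obtain ⟨l, hl, h1⟩ := hΨ.exists_isReducedExpr hg
  obtain ⟨l', hl', h2⟩ := hΨ.exists_isReducedExpr hh
  have := (hl.mul hl').len_le
  rwa [List.length_append, h1, h2] at this

/-- A simple reflection on the right whose root becomes negative shortens. -/
theorem IsBase.len_mul_refl_lt (hg : g ∈ R.group) {x : Fin n → ℝ} (hx : x ∈ Ψ)
    (hneg : -ract g x ∈ R.posRoots Ψ) : R.len Ψ (g * R.refl x) < R.len Ψ g := by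
  obtain ⟨l, ⟨hl, rfl⟩, h1⟩ := hΨ.exists_isReducedExpr hg
  obtain ⟨l', hl', h2, h3⟩ := hΨ.exchange hl (hΨ.mem_posRoots hx) hneg
  have := IsExpr.len_le (Ψ := Ψ) ⟨hl', h3⟩
  omega

/-- Reduced expressions end in a simple root that becomes negative, and what is left after the
last letter is removed is reduced. -/
theorem IsBase.reduced_concat {l : List (Fin n → ℝ)} {x : Fin n → ℝ}
    (hl : R.IsReducedExpr Ψ g (l ++ [x])) :
    x ∈ Ψ ∧ -ract g x ∈ R.posRoots Ψ ∧ R.IsReducedExpr Ψ (g * R.refl x) l := by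
  obtain ⟨⟨hl, rfl⟩, hlen⟩ := hl
  have hx : x ∈ Ψ := hl x (by simp)
  have hl' : ∀ y ∈ l, y ∈ Ψ := fun y hy => hl y (by simp [hy])
  have hu := hΨ.word_mem_group hl'
  have hprod : ((l ++ [x]).map R.refl).prod = (l.map R.refl).prod * R.refl x := by simp
  have hprod' : ((l ++ [x]).map R.refl).prod * R.refl x = (l.map R.refl).prod := by
    rw [hprod, mul_assoc, refl_mul_self, mul_one]
  rw [hprod'] 
  rw [hprod] at hlen ⊢
  rw [List.length_append, List.length_singleton] at hlen
  refine ⟨hx, ?_, ⟨hl', rfl⟩, ?_⟩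
  · rw [ract_mul (hΨ.group_of_simple hx), ract_refl_self (hΨ.1 hx), ract_neg, neg_neg]
    refine (hΨ.pos_or_neg (ract_mem_roots hu (hΨ.1 hx))).resolve_right fun h => ?_
    have h1 := hΨ.len_mul_refl_lt hu hx h
    have h2 := IsExpr.len_le (R := R) (Ψ := Ψ) ⟨hl', rfl⟩
    omega
  · have h1 := IsExpr.len_le (R := R) (Ψ := Ψ) ⟨hl', rfl⟩
    have h2 := hΨ.len_mul_le hu (hΨ.group_of_simple hx)
    have h3 := IsExpr.len_le (R := R) (Ψ := Ψ) (g := R.refl x) (l := [x])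
      ⟨by simpa using hx, by simp⟩
    rw [List.length_singleton] at h3
    omega

/-- The letters of a reduced expression of an element of a parabolic subgroup lie in it. -/
theorem IsBase.reduced_subset_simples {K : Subgroup (Cn n ≃ₗ[ℂ] Cn n)} (hK : R.IsParabolic Ψ K)
    (hg : g ∈ K) {l : List (Fin n → ℝ)} (hl : R.IsReducedExpr Ψ g l) :
    ∀ x ∈ l, x ∈ R.simples Ψ K := by
  induction l using List.reverseRecOn generalizing g with
  | nil => simp
  | append_singleton l x ih =>
    obtain ⟨hx, hneg, hl'⟩ := hΨ.reduced_concat hl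
    have hxK : x ∈ R.simples Ψ K := by
      by_contra hxK
      have h1 := hΨ.coord_ract hK hg hxK x
      have h2 := hΨ.coord_nonneg hneg x
      rw [map_neg, h1, hΨ.coord_self hx] at h2
      linarith
    intro y hy
    rcases List.mem_append.1 hy with hy | hy
    · exact ih (K.mul_mem hg hxK.2) hl' y hy
    · rw [List.mem_singleton.1 hy]; exact hxK

variable (R Ψ) in
open Classical in
/-- The positive roots of the subgroup `K`. -/
def posRootsOf (K : Subgroup (Cn n ≃ₗ[ℂ] Cn n)) : Finset (Fin n → ℝ) :=
  (R.posRoots Ψ).filter (fun x => R.refl x ∈ K)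

omit hΨ in
theorem mem_posRootsOf {K : Subgroup (Cn n ≃ₗ[ℂ] Cn n)} {y : Fin n → ℝ} :
    y ∈ R.posRootsOf Ψ K ↔ y ∈ R.posRoots Ψ ∧ R.refl y ∈ K := by
  classical
  rw [posRootsOf, Finset.mem_filter]

/-- A parabolic subgroup has an element at least as long as its number of positive roots. -/
theorem IsBase.exists_long {K : Subgroup (Cn n ≃ₗ[ℂ] Cn n)} (hK : R.IsParabolic Ψ K) :
    ∃ w ∈ K, (R.posRootsOf Ψ K).card ≤ R.len Ψ w := by
  obtain ⟨w, hw, hneg⟩ := hΨ.exists_neg_simples hK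
  have hwG := hK.le_group hΨ hw
  refine ⟨w, hw, (Finset.card_le_card fun y hy => ?_).trans (hΨ.card_inversions_le_len hwG)⟩
  obtain ⟨hy1, hy2⟩ := mem_posRootsOf.1 hy
  exact mem_inversions.2 ⟨hy1, hΨ.neg_of_neg_simples hwG hneg hy1 fun z _ hz =>
    hΨ.coord_eq_zero hK (roots_of_posRoots hy1) hy2 hz⟩

/-! ### Stabilizers of dominant functionals -/

/-- If `f` is nonnegative on the simple roots of `K`, then the stabilizer of `f` in `K` is generated
by the simple reflections it contains. -/
theorem IsBase.mem_closure_of_fixes {K : Subgroup (Cn n ≃ₗ[ℂ] Cn n)} (hK : R.IsParabolic Ψ K)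
    {f : (Fin n → ℝ) →ₗ[ℝ] ℝ} (hf : ∀ x ∈ R.simples Ψ K, 0 ≤ f x) (hg : g ∈ K)
    (hfix : ∀ y, f (ract g y) = f y) :
    g ∈ Subgroup.closure (R.refl '' {x | x ∈ R.simples Ψ K ∧ f x = 0}) := by
  obtain ⟨l, hl⟩ := hΨ.exists_isReducedExpr (hK.le_group hΨ hg)
  induction l using List.reverseRecOn generalizing g with
  | nil =>
    have : g = 1 := by simpa using hl.1.2.symm
    rw [this]
    exact Subgroup.one_mem _
  | append_singleton l x ih =>
    have hxK : x ∈ R.simples Ψ K := hΨ.reduced_subset_simples hK hg hl x (by simp)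
    obtain ⟨hx, hneg, hl'⟩ := hΨ.reduced_concat hl
    have hgx : f (ract g x) ≤ 0 := by
      rw [hΨ.sum_coord (ract_mem_roots (hK.le_group hΨ hg) (hΨ.1 hx)), map_sum]
      refine Finset.sum_nonpos fun z hz => ?_
      rw [map_smul, smul_eq_mul]
      by_cases hzK : z ∈ R.simples Ψ K
      · have h1 := hΨ.coord_nonneg hneg z
        rw [map_neg] at h1
        exact mul_nonpos_of_nonpos_of_nonneg (by linarith) (hf z hzK)
      · rw [hΨ.coord_ract hK hg hzK, hΨ.coord_of_ne hx (by rintro rfl; exact hzK hxK), zero_mul]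
    have hfx : f x = 0 := le_antisymm (hfix x ▸ hgx) (hf x hxK)
    have h1 := ih (K.mul_mem hg hxK.2) (fun y => by
      rw [ract_mul (hΨ.group_of_simple hx), hfix, ract_refl, realRefl, map_sub, map_smul, hfx,
        smul_zero, sub_zero]) hl'
    have h2 := Subgroup.mul_mem _ h1 (Subgroup.subset_closure ⟨x, ⟨hxK, hfx⟩, rfl⟩)
    rwa [mul_assoc, refl_mul_self, mul_one] at h2

omit hΨ in
theorem mem_stab {K : Subgroup (Cn n ≃ₗ[ℂ] Cn n)} {v : Cn n} :
    g ∈ stab K v ↔ g ∈ K ∧ g v = v := Iff.rfl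

/-- If `τ⁻¹` keeps the simple roots of `G'` positive and `v` has parabolic stabilizer in `G`, then
`τ v` has parabolic stabilizer in `G'`. A dominant functional `f` with the same stabilizer as `v`
reduces this to the stabilizer of `f ∘ τ⁻¹`, which is dominant for `G'`. -/
theorem IsBase.isParabolic_stab {K : Subgroup (Cn n ≃ₗ[ℂ] Cn n)} (hK : R.IsParabolic Ψ K)
    {v : Cn n} (hv : R.IsParabolic Ψ (stab R.group v)) {τ : Cn n ≃ₗ[ℂ] Cn n} (hτ : τ ∈ R.group)
    (hpos : ∀ x ∈ R.simples Ψ K, ract τ⁻¹ x ∈ R.posRoots Ψ) :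
    R.IsParabolic Ψ (stab K (τ v)) := by
  classical
  have hτ' := R.group.inv_mem hτ
  obtain ⟨f, hf⟩ := hΨ.exists_functional
    (fun x => if x ∈ R.simples Ψ (stab R.group v) then 0 else 1)
  have hf0 : ∀ x ∈ Ψ, 0 ≤ f x := fun x hx => by rw [hf x hx]; split_ifs <;> norm_num
  have hzero : ∀ x ∈ R.simples Ψ (stab R.group v), f x = 0 := fun x hx => by
    rw [hf x hx.1, if_pos hx]
  have hfv : ∀ g ∈ stab R.group v, ∀ y, f (ract g y) = f y := by
    intro g hg
    refine hv.induction (p := fun g => ∀ y, f (ract g y) = f y) (fun y => by rw [ract_one]) ?_ hg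
    intro x hx g hg ih y
    rw [ract_mul (mem_stab.1 hg).1, ract_refl, realRefl, map_sub, map_smul, hzero x hx, smul_zero,
      sub_zero, ih]
  have hfv' : ∀ g ∈ R.group, (∀ y, f (ract g y) = f y) → g ∈ stab R.group v := by
    intro g hg hfix
    have := hΨ.mem_closure_of_fixes hΨ.isParabolic_group (fun x hx => hf0 x hx.1) hg hfix
    refine (Subgroup.closure_le _).2 ?_ this
    rintro _ ⟨x, ⟨hx, hx0⟩, rfl⟩
    by_contra h
    rw [hf x hx.1, if_neg fun h' => h h'.2] at hx0
    exact one_ne_zero hx0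
  have hmap : ∀ y, (f ∘ₗ ractLin τ⁻¹) y = f (ract τ⁻¹ y) := fun y => rfl
  have key : stab K (τ v) = Subgroup.closure
      (R.refl '' {x | x ∈ R.simples Ψ K ∧ (f ∘ₗ ractLin τ⁻¹) x = 0}) := by
    refine le_antisymm (fun g hg => ?_) ((Subgroup.closure_le _).2 ?_)
    · obtain ⟨hgK, hgv⟩ := mem_stab.1 hg
      have hgG := hK.le_group hΨ hgK
      refine hΨ.mem_closure_of_fixes hK (fun x hx => ?_) hgK fun y => ?_
      · rw [hmap, hΨ.sum_coord (roots_of_posRoots (hpos x hx)), map_sum]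
        refine Finset.sum_nonneg fun z hz => ?_
        rw [map_smul]
        exact mul_nonneg (hΨ.coord_nonneg (hpos x hx) z) (hf0 z hz)
      · have h1 : τ⁻¹ * g * τ ∈ stab R.group v := by
          refine mem_stab.2 ⟨R.group.mul_mem (R.group.mul_mem hτ' hgG) hτ, ?_⟩
          rw [LinearEquiv.mul_apply, LinearEquiv.mul_apply, hgv]
          exact τ.symm_apply_apply v
        have h2 := hfv _ h1 (ract τ⁻¹ y)
        rw [ract_mul hτ, ract_ract_inv hτ, ract_mul hgG] at h2
        rw [hmap, hmap, h2]
    · rintro _ ⟨x, ⟨hx, hx0⟩, rfl⟩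
      rw [hmap] at hx0
      have h1 : R.refl (ract τ⁻¹ x) ∈ stab R.group v := by
        refine hfv' _ (R.refl_mem_group (roots_of_posRoots (hpos x hx))) fun y => ?_
        rw [ract_refl, realRefl, map_sub, map_smul, hx0, smul_zero, sub_zero]
      rw [refl_ract hτ', inv_inv] at h1
      refine mem_stab.2 ⟨hx.2, ?_⟩
      have h2 := congrArg τ (mem_stab.1 h1).2
      rw [LinearEquiv.mul_apply, LinearEquiv.mul_apply] at h2
      rwa [show τ (τ⁻¹ (R.refl x (τ v))) = R.refl x (τ v) from τ.apply_symm_apply _] at h2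
  rw [key]
  exact IsParabolic.of_eq_closure fun x hx => hx.1.1

/-- Every coset of a parabolic subgroup contains an element whose inverse keeps the simple roots of
the subgroup positive. -/
theorem IsBase.exists_coset_rep {K : Subgroup (Cn n ≃ₗ[ℂ] Cn n)}
    (hg : g ∈ R.group) :
    ∃ τ ∈ R.group, g * τ⁻¹ ∈ K ∧ ∀ x ∈ R.simples Ψ K, ract τ⁻¹ x ∈ R.posRoots Ψ := by
  obtain ⟨τ, ⟨hτ, hgτ, hlen⟩⟩ := Nat.sInf_mem
    (⟨_, g, hg, by rw [mul_inv_cancel]; exact K.one_mem, rfl⟩ :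
      Set.Nonempty {k | ∃ τ, τ ∈ R.group ∧ g * τ⁻¹ ∈ K ∧ R.len Ψ τ⁻¹ = k})
  have hτ' := R.group.inv_mem hτ
  refine ⟨τ, hτ, hgτ, fun x hx => ?_⟩
  refine (hΨ.pos_or_neg (ract_mem_roots hτ' (hΨ.1 hx.1))).resolve_right fun hneg => ?_
  have h1 := hΨ.len_mul_refl_lt hτ' hx.1 hneg
  rw [hlen] at h1
  refine absurd (Nat.sInf_le ?_) (not_le.2 h1)
  refine ⟨R.refl x * τ, R.group.mul_mem (hΨ.group_of_simple hx.1) hτ, ?_, ?_⟩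
  · rw [mul_inv_rev, ← mul_assoc, refl_inv]
    exact K.mul_mem hgτ hx.2
  · rw [mul_inv_rev, refl_inv]

end RootSys

/-! ### Expanding words of divided differences in a skew group algebra -/

section Words

variable {W X M : Type*} [Group W] [Field M] [MulSemiringAction W M] (s : X → W) (γ : X → M)

open Classical in
/-- The coefficient of `g` in the product of the operators `γ_x⁻¹ (1 - s_x)` over the letters `x`
of a word, expanded in the skew group algebra of `W` over the field `M`. -/
def wordCoeff : List X → W → M
  | [], g => if g = 1 then 1 else 0
  | x :: l, g => (γ x)⁻¹ * (wordCoeff l g - s x • wordCoeff l ((s x)⁻¹ * g))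

theorem wordCoeff_cons (x : X) (l : List X) (g : W) : wordCoeff s γ (x :: l) g =
    (γ x)⁻¹ * (wordCoeff s γ l g - s x • wordCoeff s γ l ((s x)⁻¹ * g)) := rfl

theorem wordCoeff_nil_of_ne {g : W} (hg : g ≠ 1) : wordCoeff s γ [] g = 0 := if_neg hg

theorem wordCoeff_nil_one : wordCoeff s γ [] (1 : W) = 1 := if_pos rfl

variable {s γ}

/-- Only products of subwords occur in the expansion of a word. -/
theorem exists_sublist_of_wordCoeff_ne_zero {l : List X} {g : W}
    (h : wordCoeff s γ l g ≠ 0) : ∃ l' : List X, l'.Sublist l ∧ (l'.map s).prod = g := by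
  induction l generalizing g with
  | nil =>
    have : g = 1 := by
      by_contra hg
      exact h (wordCoeff_nil_of_ne s γ hg)
    exact ⟨[], List.Sublist.refl _, by simp [this]⟩
  | cons x l ih =>
    by_cases h1 : wordCoeff s γ l g = 0
    · have h2 : wordCoeff s γ l ((s x)⁻¹ * g) ≠ 0 := by
        intro h2
        rw [wordCoeff_cons, h1, h2, smul_zero, sub_zero, mul_zero] at h
        exact h rfl
      obtain ⟨l', hl', hg⟩ := ih h2
      refine ⟨x :: l', hl'.cons_cons x, ?_⟩
      rw [List.map_cons, List.prod_cons, hg, mul_inv_cancel_left]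
    · obtain ⟨l', hl', hg⟩ := ih h1
      exact ⟨l', hl'.cons x, hg⟩

theorem wordCoeff_append (K : Subgroup W) [Fintype K] {l : List X} (hl : ∀ x ∈ l, s x ∈ K)
    (l' : List X) (g : W) :
    wordCoeff s γ (l ++ l') g =
      ∑ h : K, wordCoeff s γ l h * (h : W) • wordCoeff s γ l' ((h : W)⁻¹ * g) := by
  classical
  induction l generalizing g with
  | nil =>
    rw [Finset.sum_eq_single (1 : K)]
    · simp [wordCoeff_nil_one]
    · intro h _ hh
      rw [wordCoeff_nil_of_ne s γ (by simpa using hh), zero_mul]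
    · simp
  | cons x l ih =>
    have hl' : ∀ y ∈ l, s y ∈ K := fun y hy => hl y (by simp [hy])
    have hx : s x ∈ K := hl x (by simp)
    rw [List.cons_append, wordCoeff_cons, ih hl', ih hl', Finset.smul_sum,
      ← Equiv.sum_comp (Equiv.mulLeft (⟨s x, hx⟩⁻¹ : K))
        (fun h : K => s x • (wordCoeff s γ l h *
          (h : W) • wordCoeff s γ l' ((h : W)⁻¹ * ((s x)⁻¹ * g)))),
      ← Finset.sum_sub_distrib, Finset.mul_sum]
    refine Finset.sum_congr rfl fun h _ => ?_
    rw [wordCoeff_cons]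
    simp only [Equiv.coe_mulLeft, Subgroup.coe_mul, Subgroup.coe_inv, smul_mul', smul_smul,
      mul_inv_rev, inv_inv, mul_inv_cancel_left, mul_assoc]
    ring

theorem foldr_divDiff_eq_sum {A : Type*} [AddCommGroup A] [Module M A] [DistribMulAction W A]
    (hsemi : ∀ (g : W) (m : M) (a : A), g • (m • a) = (g • m) • (g • a))
    (K : Subgroup W) [Fintype K] {l : List X} (hl : ∀ x ∈ l, s x ∈ K) (a : A) :
    l.foldr (fun x b => (γ x)⁻¹ • (b - s x • b)) a =
      ∑ g : K, wordCoeff s γ l g • ((g : W) • a) := by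
  classical
  induction l with
  | nil =>
    rw [Finset.sum_eq_single (1 : K)]
    · simp [wordCoeff_nil_one]
    · intro h _ hh
      rw [wordCoeff_nil_of_ne s γ (by simpa using hh), zero_smul]
    · simp
  | cons x l ih =>
    have hl' : ∀ y ∈ l, s y ∈ K := fun y hy => hl y (by simp [hy])
    have hx : s x ∈ K := hl x (by simp)
    have h1 : s x • ∑ g : K, wordCoeff s γ l g • ((g : W) • a) =
        ∑ g : K, (s x • wordCoeff s γ l ((s x)⁻¹ * g)) • ((g : W) • a) := by
      rw [Finset.smul_sum, ← Equiv.sum_comp (Equiv.mulLeft (⟨s x, hx⟩⁻¹ : K))]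
      refine Finset.sum_congr rfl fun h _ => ?_
      simp only [Equiv.coe_mulLeft, Subgroup.coe_mul, Subgroup.coe_inv]
      rw [hsemi, smul_smul (s x), mul_inv_cancel_left]
    rw [List.foldr_cons, ih hl', h1, ← Finset.sum_sub_distrib, Finset.smul_sum]
    refine Finset.sum_congr rfl fun h _ => ?_
    rw [wordCoeff_cons, ← sub_smul, smul_smul]

end Words

/-! ### Polynomials, linear forms and the group action -/

section Polynomials

open MvPolynomial

/-- The polynomial of a linear form on `V`. -/
def linPoly (f : Cn n →ₗ[ℂ] ℂ) : MvPolynomial (Fin n) ℂ :=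
  ∑ i, C (f (Pi.single i 1)) * X i

theorem eval_linPoly (f : Cn n →ₗ[ℂ] ℂ) (y : Cn n) : eval y (linPoly f) = f y := by
  conv_rhs => rw [pi_eq_sum_univ' y, map_sum]
  simp [linPoly, mul_comm]

theorem totalDegree_linPoly_le (f : Cn n →ₗ[ℂ] ℂ) : (linPoly f).totalDegree ≤ 1 := by
  refine totalDegree_finsetSum_le fun i _ => ?_
  refine (totalDegree_mul _ _).trans ?_
  simp

theorem linPoly_ne_zero {f : Cn n →ₗ[ℂ] ℂ} (hf : f ≠ 0) : linPoly f ≠ 0 := fun h =>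
  hf (LinearMap.ext fun y => by rw [← eval_linPoly, h]; simp)

theorem totalDegree_linPoly {f : Cn n →ₗ[ℂ] ℂ} (hf : f ≠ 0) : (linPoly f).totalDegree = 1 := by
  refine le_antisymm (totalDegree_linPoly_le f) (Nat.one_le_iff_ne_zero.2 fun h => ?_)
  rw [totalDegree_eq_zero_iff_eq_C] at h
  -- a linear form that is constant vanishes, as it does at the origin
  refine hf (LinearMap.ext fun y => ?_)
  have h1 := eval_linPoly f y
  have h2 := eval_linPoly f 0
  rw [h, eval_C] at h1 h2
  rw [← h1, h2, map_zero, LinearMap.zero_apply]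

theorem prime_linPoly {f : Cn n →ₗ[ℂ] ℂ} (hf : f ≠ 0) : Prime (linPoly f) := by
  refine Irreducible.prime (irreducible_of_totalDegree_eq_one (totalDegree_linPoly hf) ?_)
  intro c hc
  refine isUnit_iff_ne_zero.2 fun h0 => linPoly_ne_zero hf ?_
  ext m
  have := hc m
  rw [h0, zero_dvd_iff] at this
  rw [this, coeff_zero]

/-- Only proportional linear forms divide each other. -/
theorem exists_smul_of_linPoly_dvd {f f' : Cn n →ₗ[ℂ] ℂ} (hf' : f' ≠ 0)
    (h : linPoly f ∣ linPoly f') : ∃ c : ℂ, f' = c • f := by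
  obtain ⟨q, hq⟩ := h
  have h0 : linPoly f' ≠ 0 := linPoly_ne_zero hf'
  rw [hq] at h0
  have hf : f ≠ 0 := by
    rintro rfl
    exact left_ne_zero_of_mul h0 (by simp [linPoly])
  have hdeg := congrArg totalDegree hq
  rw [totalDegree_mul_of_isDomain (left_ne_zero_of_mul h0) (right_ne_zero_of_mul h0),
    totalDegree_linPoly hf, totalDegree_linPoly hf'] at hdeg
  have hq0 := totalDegree_eq_zero_iff_eq_C.1 (by omega : q.totalDegree = 0)
  refine ⟨q.coeff 0, LinearMap.ext fun y => ?_⟩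
  rw [← eval_linPoly f' y, hq, map_mul, eval_linPoly, hq0, eval_C]
  simp [mul_comm]

/-- The action of `g ∈ GL(V)` on polynomials, `P ↦ P ∘ g⁻¹`. -/
def pushPoly (g : Cn n ≃ₗ[ℂ] Cn n) : MvPolynomial (Fin n) ℂ →ₐ[ℂ] MvPolynomial (Fin n) ℂ :=
  aeval fun i => linPoly (LinearMap.proj i ∘ₗ (g⁻¹ : Cn n ≃ₗ[ℂ] Cn n).toLinearMap)

theorem eval_pushPoly (g : Cn n ≃ₗ[ℂ] Cn n) (P : MvPolynomial (Fin n) ℂ) (y : Cn n) :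
    eval y (pushPoly g P) = eval (g⁻¹ y) P := by
  have : (eval y).comp (pushPoly g).toRingHom = eval (g⁻¹ y) := by
    ext i
    · simp
    · simp [pushPoly, eval_linPoly]
  exact congrArg (fun φ => φ P) this

theorem pushPoly_mul (g h : Cn n ≃ₗ[ℂ] Cn n) (P : MvPolynomial (Fin n) ℂ) :
    pushPoly (g * h) P = pushPoly g (pushPoly h P) := by
  refine MvPolynomial.funext fun y => ?_
  rw [eval_pushPoly, eval_pushPoly, eval_pushPoly, mul_inv_rev, LinearEquiv.mul_apply]

theorem pushPoly_one (P : MvPolynomial (Fin n) ℂ) :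
    pushPoly (1 : Cn n ≃ₗ[ℂ] Cn n) P = P := by
  refine MvPolynomial.funext fun y => ?_
  rw [eval_pushPoly, inv_one]
  rfl

theorem totalDegree_pushPoly_le (g : Cn n ≃ₗ[ℂ] Cn n) (P : MvPolynomial (Fin n) ℂ) :
    (pushPoly g P).totalDegree ≤ P.totalDegree := by
  rw [pushPoly, aeval_def, eval₂_eq']
  refine totalDegree_finsetSum_le fun m hm => ?_
  refine (totalDegree_mul _ _).trans ?_
  rw [algebraMap_eq, totalDegree_C, zero_add]
  refine (totalDegree_finsetProd _ _).trans ?_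
  refine le_trans (Finset.sum_le_sum fun i _ => ?_) (?_ : ∑ i, m i ≤ _)
  · exact (totalDegree_pow _ _).trans
      ((Nat.mul_le_mul_left _ (totalDegree_linPoly_le _)).trans (mul_one _).le)
  · rw [← Finsupp.sum_fintype m (fun _ e => e) (fun _ => rfl)]
    exact le_totalDegree hm

/-- Polynomials as entire functions. -/
def polyHolHom : MvPolynomial (Fin n) ℂ →+* Hol n where
  toFun := polyHol
  map_one' := Subtype.ext (funext fun x => map_one (eval x))
  map_mul' P Q := Subtype.ext (funext fun x => (eval x).map_mul P Q)
  map_zero' := Subtype.ext (funext fun x => map_zero (eval x))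
  map_add' P Q := Subtype.ext (funext fun x => map_add (eval x) P Q)

theorem polyHolHom_injective : Function.Injective (polyHolHom (n := n)) := fun _ _ h =>
  MvPolynomial.funext fun x => congrFun (congrArg Subtype.val h) x

theorem pushHol_polyHol (g : Cn n ≃ₗ[ℂ] Cn n) (P : MvPolynomial (Fin n) ℂ) :
    pushHol g.toAffineEquiv (polyHol P) = polyHol (pushPoly g P) :=
  Subtype.ext (funext fun x => (eval_pushPoly g P x).symm)

/-- Polynomials as meromorphic functions. -/
def polyMer : MvPolynomial (Fin n) ℂ →+* Mer n := (algebraMap (Hol n) (Mer n)).comp polyHolHom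

theorem polyMer_apply (P : MvPolynomial (Fin n) ℂ) :
    polyMer (n := n) P = algebraMap (Hol n) (Mer n) (polyHol P) := rfl

theorem polyMer_injective : Function.Injective (polyMer (n := n)) :=
  (IsFractionRing.injective (Hol n) (Mer n)).comp polyHolHom_injective

theorem polyMer_ne_zero {P : MvPolynomial (Fin n) ℂ} (hP : P ≠ 0) :
    polyMer (n := n) P ≠ 0 := fun h =>
  hP (polyMer_injective (h.trans (RingHom.map_zero polyMer).symm))

theorem polyMer_C (c : ℂ) : polyMer (n := n) (C c) = algebraMap ℂ (Mer n) c := by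
  rw [IsScalarTower.algebraMap_apply ℂ (Hol n) (Mer n), polyMer_apply]
  congr 1
  exact Subtype.ext (funext fun x => eval_C c)

theorem pushMer_polyMer (g : Cn n ≃ₗ[ℂ] Cn n) (P : MvPolynomial (Fin n) ℂ) :
    pushMer g.toAffineEquiv (polyMer (n := n) P) = polyMer (n := n) (pushPoly g P) := by
  rw [polyMer_apply, pushMer_algebraMap, pushHol_polyHol]
  rfl

namespace RootSys

variable {R : RootSys n} {g h : Cn n ≃ₗ[ℂ] Cn n} {Ψ : Finset (Fin n → ℝ)}

theorem gammaLin_ne_zero {x : Fin n → ℝ} (hx : x ∈ R.roots) : R.gammaLin x ≠ 0 := by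
  intro h
  have h1 := R.gammaLin_toCn x x
  rw [h, LinearMap.zero_apply] at h1
  exact R.anisotropic x hx (by exact_mod_cast h1.symm)

variable (R) in
/-- `γ_x` as a polynomial. -/
def gammaPoly (x : Fin n → ℝ) : MvPolynomial (Fin n) ℂ := linPoly (R.gammaLin x)

theorem eval_gammaPoly (x : Fin n → ℝ) (y : Cn n) : eval y (R.gammaPoly x) = R.gammaLin x y :=
  eval_linPoly _ _

theorem gammaPoly_ne_zero {x : Fin n → ℝ} (hx : x ∈ R.roots) : R.gammaPoly x ≠ 0 :=
  linPoly_ne_zero (gammaLin_ne_zero hx)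

theorem polyMer_gammaPoly (x : Fin n → ℝ) : polyMer (n := n) (R.gammaPoly x) = R.gammaMer x := by
  rw [polyMer_apply, gammaMer]
  congr 1
  exact Subtype.ext (funext fun y => eval_gammaPoly x y)

theorem gammaMer_ne_zero {x : Fin n → ℝ} (hx : x ∈ R.roots) : R.gammaMer x ≠ 0 := by
  rw [← polyMer_gammaPoly]
  exact polyMer_ne_zero (gammaPoly_ne_zero hx)

theorem gammaPoly_neg (x : Fin n → ℝ) : R.gammaPoly (-x) = -R.gammaPoly x :=
  MvPolynomial.funext fun y => by rw [map_neg, eval_gammaPoly, eval_gammaPoly, gammaLin_neg]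

theorem pushPoly_gammaPoly (hg : g ∈ R.group) (x : Fin n → ℝ) :
    pushPoly g (R.gammaPoly x) = R.gammaPoly (ract g x) := by
  refine MvPolynomial.funext fun y => ?_
  rw [eval_pushPoly, eval_gammaPoly, eval_gammaPoly, ← gammaLin_ract hg]
  exact congrArg _ (g.apply_symm_apply y)

/-- Distinct positive roots have coprime linear forms. -/
theorem eq_of_gammaPoly_dvd (hΨ : R.IsBase Ψ) {x y : Fin n → ℝ} (hx : x ∈ R.posRoots Ψ)
    (hy : y ∈ R.posRoots Ψ) (h : R.gammaPoly y ∣ R.gammaPoly x) : x = y := by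
  obtain ⟨c, hc⟩ := exists_smul_of_linPoly_dvd (gammaLin_ne_zero (roots_of_posRoots hx)) h
  have hyR := roots_of_posRoots hy
  have hxR := roots_of_posRoots hx
  have hform : ∀ z, ((R.form x z : ℝ) : ℂ) = c * ((R.form y z : ℝ) : ℂ) := fun z => by
    rw [← gammaLin_toCn, ← gammaLin_toCn, hc]; rfl
  have hre : ∀ z, R.form x z = c.re * R.form y z := fun z => by
    have := congrArg Complex.re (hform z)
    rwa [Complex.re_mul_ofReal, Complex.ofReal_re] at this
  have hxy : x = c.re • y := by
    have : ∀ z, R.form (x - c.re • y) z = 0 := fun z => by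
      rw [map_sub, map_smul, LinearMap.sub_apply, LinearMap.smul_apply, hre, smul_eq_mul, sub_self]
    exact sub_eq_zero.1 (R.nondegenerate.1 _ this)
  rcases R.reduced y hyR c.re (hxy ▸ hxR) with h1 | h1
  · rw [hxy, h1, one_smul]
  · rw [h1, neg_one_smul] at hxy
    exact absurd (hxy ▸ hx) (hΨ.neg_notMem_posRoots hy)

/-- A polynomial and its reflection agree on the mirror. -/
theorem gammaPoly_dvd_sub_pushPoly (x : Fin n → ℝ) (P : MvPolynomial (Fin n) ℂ) :
    R.gammaPoly x ∣ P - pushPoly (R.refl x) P := by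
  induction P using MvPolynomial.induction_on with
  | C a => simp [pushPoly]
  | add P Q hP hQ =>
    rw [map_add, add_sub_add_comm]
    exact dvd_add hP hQ
  | mul_X P i hP =>
    have h1 : R.gammaPoly x ∣ X i - pushPoly (R.refl x) (X i) := by
      refine ⟨C (((2 / R.form x x : ℝ) : ℂ) * toCn x i), MvPolynomial.funext fun y => ?_⟩
      rw [map_sub, eval_pushPoly, refl_inv, map_mul, eval_X, eval_X, eval_C, eval_gammaPoly,
        refl_apply, Pi.sub_apply, Pi.smul_apply, smul_eq_mul]
      ring
    have h2 : P * X i - pushPoly (R.refl x) (P * X i) =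
        (P - pushPoly (R.refl x) P) * X i +
          pushPoly (R.refl x) P * (X i - pushPoly (R.refl x) (X i)) := by
      rw [map_mul]; ring
    rw [h2]
    exact dvd_add (dvd_mul_of_dvd_left hP _) (dvd_mul_of_dvd_right h1 _)

variable (R Ψ) in
/-- The product of the linear forms of the positive roots of `K`, as a polynomial. -/
def deltaPoly (K : Subgroup (Cn n ≃ₗ[ℂ] Cn n)) : MvPolynomial (Fin n) ℂ :=
  ∏ x ∈ R.posRootsOf Ψ K, R.gammaPoly x

theorem polyMer_deltaPoly (K : Subgroup (Cn n ≃ₗ[ℂ] Cn n)) :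
    polyMer (n := n) (R.deltaPoly Ψ K) = R.delta Ψ K := by
  rw [deltaPoly, map_prod]
  exact Finset.prod_congr rfl fun x _ => polyMer_gammaPoly x

theorem deltaPoly_ne_zero (K : Subgroup (Cn n ≃ₗ[ℂ] Cn n)) : R.deltaPoly Ψ K ≠ 0 :=
  Finset.prod_ne_zero_iff.2 fun _ hx =>
    gammaPoly_ne_zero (roots_of_posRoots (mem_posRootsOf.1 hx).1)

theorem delta_ne_zero (K : Subgroup (Cn n ≃ₗ[ℂ] Cn n)) : R.delta Ψ K ≠ 0 := by
  rw [← polyMer_deltaPoly]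
  exact polyMer_ne_zero (deltaPoly_ne_zero K)

theorem totalDegree_deltaPoly_le (K : Subgroup (Cn n ≃ₗ[ℂ] Cn n)) :
    (R.deltaPoly Ψ K).totalDegree ≤ (R.posRootsOf Ψ K).card := by
  refine (totalDegree_finsetProd _ _).trans ?_
  refine (Finset.sum_le_card_nsmul _ _ 1 fun x _ => totalDegree_linPoly_le _).trans ?_
  simp

theorem realRefl_mem_posRootsOf (hΨ : R.IsBase Ψ) {K : Subgroup (Cn n ≃ₗ[ℂ] Cn n)}
    {x y : Fin n → ℝ} (hx : x ∈ R.simples Ψ K) (hy : y ∈ R.posRootsOf Ψ K) (hyx : y ≠ x) :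
    R.realRefl x y ∈ R.posRootsOf Ψ K := by
  obtain ⟨h1, h2⟩ := mem_posRootsOf.1 hy
  refine mem_posRootsOf.2 ⟨hΨ.realRefl_pos hx.1 h1 hyx, ?_⟩
  rw [← ract_refl, refl_ract (hΨ.group_of_simple hx.1), refl_inv]
  exact K.mul_mem (K.mul_mem hx.2 h2) hx.2

theorem pushPoly_deltaPoly (hΨ : R.IsBase Ψ) {K : Subgroup (Cn n ≃ₗ[ℂ] Cn n)}
    {x : Fin n → ℝ} (hx : x ∈ R.simples Ψ K) :
    pushPoly (R.refl x) (R.deltaPoly Ψ K) = -R.deltaPoly Ψ K := by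
  classical
  have hxR := hΨ.1 hx.1
  have hxG := hΨ.group_of_simple hx.1
  have hxK : x ∈ R.posRootsOf Ψ K := mem_posRootsOf.2 ⟨hΨ.mem_posRoots hx.1, hx.2⟩
  have hinv := R.realRefl_realRefl (R.anisotropic x hxR)
  have hmaps : ∀ y ∈ (R.posRootsOf Ψ K).erase x, R.realRefl x y ∈ (R.posRootsOf Ψ K).erase x := by
    intro y hy
    obtain ⟨hyx, hy⟩ := Finset.mem_erase.1 hy
    refine Finset.mem_erase.2 ⟨fun h => ?_, realRefl_mem_posRootsOf hΨ hx hy hyx⟩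
    have h2 := hinv y
    rw [h, realRefl_self hxR] at h2
    exact hΨ.neg_notMem_posRoots (hΨ.mem_posRoots hx.1) (h2 ▸ (mem_posRootsOf.1 hy).1)
  rw [deltaPoly, ← Finset.mul_prod_erase _ _ hxK, map_mul, map_prod, pushPoly_gammaPoly hxG,
    ract_refl_self hxR, gammaPoly_neg, neg_mul]
  congr 2
  refine Finset.prod_nbij' (R.realRefl x) (R.realRefl x) hmaps hmaps (fun y _ => hinv y)
    (fun y _ => hinv y) fun y _ => ?_
  rw [pushPoly_gammaPoly hxG, ract_refl]

end RootSys

end Polynomials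

/-! ### Numerators of the coefficients of words -/

/-- The action of `GL(V)` on meromorphic functions by field automorphisms. -/
@[reducible] def merAction : MulSemiringAction (Cn n ≃ₗ[ℂ] Cn n) (Mer n) where
  smul g f := pushMer g.toAffineEquiv f
  one_smul := pushMer_linear_one
  mul_smul := pushMer_linear_mul
  smul_zero g := map_zero (pushMer g.toAffineEquiv)
  smul_add g := (pushMer g.toAffineEquiv).map_add'
  smul_one g := map_one (pushMer g.toAffineEquiv)
  smul_mul g := (pushMer g.toAffineEquiv).map_mul'

section Numerators

attribute [local instance] merAction

open MvPolynomial

namespace RootSys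

variable {R : RootSys n} {g h : Cn n ≃ₗ[ℂ] Cn n} {Ψ : Finset (Fin n → ℝ)}
  {K : Subgroup (Cn n ≃ₗ[ℂ] Cn n)}

theorem smul_polyMer (g : Cn n ≃ₗ[ℂ] Cn n) (P : MvPolynomial (Fin n) ℂ) :
    g • polyMer (n := n) P = polyMer (n := n) (pushPoly g P) := pushMer_polyMer g P

theorem smul_algebraMap (g : Cn n ≃ₗ[ℂ] Cn n) (c : ℂ) :
    g • algebraMap ℂ (Mer n) c = algebraMap ℂ (Mer n) c := (pushMer g.toAffineEquiv).commutes c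

theorem smul_div_mer (g : Cn n ≃ₗ[ℂ] Cn n) (f f' : Mer n) : g • (f / f') = (g • f) / (g • f') :=
  map_div₀ (pushMer g.toAffineEquiv) f f'

theorem smul_mer_ne_zero (g : Cn n ≃ₗ[ℂ] Cn n) {f : Mer n} (hf : f ≠ 0) : g • f ≠ 0 :=
  fun h => hf ((pushMer g.toAffineEquiv).injective (h.trans (map_zero _).symm))

variable (R Ψ K) in
/-- The conditions met by the polynomials `P_g` for which a word of length `d` in the divided
differences of `K` expands as `∑ (P_g / Δ_K) g`: a bound for the degrees, and the cancellation of
poles along the mirror of each root `β` between the terms of `g` and `σ_β g`. -/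
def IsNumerator (d : ℕ) (P : (Cn n ≃ₗ[ℂ] Cn n) → MvPolynomial (Fin n) ℂ) : Prop :=
  (∀ g ∈ K, P g ≠ 0 → (P g).totalDegree + d ≤ (R.posRootsOf Ψ K).card) ∧
    ∀ g ∈ K, ∀ β ∈ R.posRootsOf Ψ K, R.gammaPoly β ∣ P g + P (R.refl β * g)

open Classical in
theorem isNumerator_one :
    R.IsNumerator Ψ K 0 (fun g => if g = 1 then R.deltaPoly Ψ K else 0) := by
  refine ⟨fun g _ hP => ?_, fun g _ β hβ => ?_⟩
  · dsimp only
    split_ifs with h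
    · exact totalDegree_deltaPoly_le K
    · simp
  · have : R.gammaPoly β ∣ R.deltaPoly Ψ K := Finset.dvd_prod_of_mem _ hβ
    refine dvd_add ?_ ?_ <;> dsimp only <;> split_ifs <;> simp [this]

/-- Applying one more divided difference keeps the numerators polynomial and lowers their degree.
The poles along the new mirror cancel, since a function and its reflection agree there. -/
theorem IsNumerator.step (hΨ : R.IsBase Ψ) {d : ℕ}
    {P : (Cn n ≃ₗ[ℂ] Cn n) → MvPolynomial (Fin n) ℂ} (hP : R.IsNumerator Ψ K d P)
    {x : Fin n → ℝ} (hx : x ∈ R.simples Ψ K) :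
    ∃ P', R.IsNumerator Ψ K (d + 1) P' ∧ ∀ g ∈ K,
      R.gammaPoly x * P' g = P g + pushPoly (R.refl x) (P (R.refl x * g)) := by
  have hxR := hΨ.1 hx.1
  have hxG := hΨ.group_of_simple hx.1
  have hxK : x ∈ R.posRootsOf Ψ K := mem_posRootsOf.2 ⟨hΨ.mem_posRoots hx.1, hx.2⟩
  have hγ := gammaPoly_ne_zero hxR
  have hdvd : ∀ g ∈ K, ∃ Q, R.gammaPoly x * Q = P g + pushPoly (R.refl x) (P (R.refl x * g)) := by
    intro g hg
    have h1 := dvd_sub (hP.2 g hg x hxK) (gammaPoly_dvd_sub_pushPoly (R := R) x (P (R.refl x * g)))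
    obtain ⟨Q, hQ⟩ := h1
    exact ⟨Q, by rw [← hQ]; ring⟩
  choose! P' hP' using hdvd
  refine ⟨P', ⟨fun g hg h0 => ?_, fun g hg β hβ => ?_⟩, hP'⟩
  · have hxg := K.mul_mem hx.2 hg
    have h1 : (P' g).totalDegree + 1 =
        (P g + pushPoly (R.refl x) (P (R.refl x * g))).totalDegree := by
      rw [← hP' g hg, totalDegree_mul_of_isDomain hγ h0,
        gammaPoly, totalDegree_linPoly (gammaLin_ne_zero hxR), add_comm]
    have h2 := (totalDegree_add (P g) (pushPoly (R.refl x) (P (R.refl x * g)))).trans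
      (max_le_max_left _ (totalDegree_pushPoly_le _ _))
    have h3 := hP.1 g hg
    have h4 := hP.1 _ hxg
    by_cases hz : P g = 0
    · have hz' : P (R.refl x * g) ≠ 0 := by
        intro hz'
        have h5 := hP' g hg
        rw [hz, hz', map_zero, add_zero] at h5
        exact mul_ne_zero hγ h0 h5
      have h6 := h4 hz'
      have h7 : (P g).totalDegree = 0 := by rw [hz, totalDegree_zero]
      omega
    · have h6 := h3 hz
      by_cases hz' : P (R.refl x * g) = 0
      · have h7 : (P (R.refl x * g)).totalDegree = 0 := by rw [hz', totalDegree_zero]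
        omega
      · have h7 := h4 hz'
        omega
  · have hβ' := mem_posRootsOf.1 hβ
    have hβg := K.mul_mem hβ'.2 hg
    by_cases hβx : β = x
    · subst hβx
      obtain ⟨Q, hQ⟩ := hP.2 g hg β hβ
      have h1 : R.gammaPoly β * (P' g + P' (R.refl β * g)) =
          R.gammaPoly β * (Q - pushPoly (R.refl β) Q) := by
        rw [mul_add, hP' g hg, hP' _ hβg, refl_mul_refl_mul]
        have h2 := congrArg (pushPoly (R.refl β)) hQ
        rw [map_add, map_mul, pushPoly_gammaPoly hxG, ract_refl_self hxR, gammaPoly_neg] at h2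
        linear_combination hQ + h2
      rw [mul_left_cancel₀ hγ h1]
      exact gammaPoly_dvd_sub_pushPoly β Q
    · have h1 : R.gammaPoly β ∣ R.gammaPoly x * (P' g + P' (R.refl β * g)) := by
        have hβ₂ := realRefl_mem_posRootsOf hΨ hx hβ hβx
        have h2 := hP.2 _ (K.mul_mem hx.2 hg) _ hβ₂
        have h3 : R.refl (R.realRefl x β) * (R.refl x * g) = R.refl x * (R.refl β * g) := by
          rw [← ract_refl, refl_ract hxG, refl_inv]
          simp only [mul_assoc, refl_mul_refl_mul]
        rw [h3] at h2
        have h4 := map_dvd (pushPoly (R.refl x)) h2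
        rw [pushPoly_gammaPoly hxG, ract_refl, R.realRefl_realRefl (R.anisotropic x hxR),
          map_add] at h4
        have h5 := dvd_add (hP.2 g hg β hβ) h4
        rw [mul_add, hP' g hg, hP' _ hβg]
        convert h5 using 1
        ring
      refine ((prime_linPoly (gammaLin_ne_zero (roots_of_posRoots hβ'.1))).dvd_or_dvd
        h1).resolve_left fun h2 => ?_
      exact hβx (eq_of_gammaPoly_dvd hΨ (hΨ.mem_posRoots hx.1) hβ'.1 h2).symm

theorem smul_delta (hΨ : R.IsBase Ψ) {x : Fin n → ℝ} (hx : x ∈ R.simples Ψ K) :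
    R.refl x • R.delta Ψ K = -R.delta Ψ K := by
  rw [← polyMer_deltaPoly, smul_polyMer, pushPoly_deltaPoly hΨ hx, RingHom.map_neg]

/-- The coefficients of a word of `K` have the numerators just described over `Δ_K`. -/
theorem exists_isNumerator (hΨ : R.IsBase Ψ) {l : List (Fin n → ℝ)}
    (hl : ∀ x ∈ l, x ∈ R.simples Ψ K) :
    ∃ P, R.IsNumerator Ψ K l.length P ∧
      ∀ g ∈ K, wordCoeff R.refl R.gammaMer l g = polyMer (n := n) (P g) / R.delta Ψ K := by
  classical
  induction l with
  | nil =>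
    refine ⟨_, isNumerator_one, fun g _ => ?_⟩
    by_cases hg : g = 1
    · rw [hg, wordCoeff_nil_one, if_pos rfl, polyMer_deltaPoly, div_self (delta_ne_zero K)]
    · rw [wordCoeff_nil_of_ne _ _ hg, if_neg hg, RingHom.map_zero, zero_div]
  | cons x l ih =>
    have hx := hl x (by simp)
    obtain ⟨P, hP, hc⟩ := ih fun y hy => hl y (by simp [hy])
    obtain ⟨P', hP', hc'⟩ := hP.step hΨ hx
    refine ⟨P', hP', fun g hg => ?_⟩
    have h1 := congrArg (polyMer (n := n)) (hc' g hg)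
    rw [RingHom.map_mul, RingHom.map_add, polyMer_gammaPoly] at h1
    have hγ := gammaMer_ne_zero (hΨ.1 hx.1)
    rw [wordCoeff_cons, refl_inv, hc g hg, hc _ (K.mul_mem hx.2 hg), smul_div_mer, smul_polyMer,
      smul_delta hΨ hx, div_neg, sub_neg_eq_add, ← add_div, ← h1, mul_div_assoc,
      inv_mul_cancel_left₀ hγ]

/-- Words longer than the number of positive roots vanish. -/
theorem wordCoeff_eq_zero (hΨ : R.IsBase Ψ) {l : List (Fin n → ℝ)}
    (hl : ∀ x ∈ l, x ∈ R.simples Ψ K) (hlen : (R.posRootsOf Ψ K).card < l.length) (hg : g ∈ K) :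
    wordCoeff R.refl R.gammaMer l g = 0 := by
  obtain ⟨P, hP, hc⟩ := exists_isNumerator hΨ hl
  have : P g = 0 := by
    by_contra h
    have := hP.1 g hg h
    omega
  rw [hc g hg, this, RingHom.map_zero, zero_div]

/-- For a word as long as the number of positive roots the numerators are constants, for reasons of
degree, and they alternate, by the cancellation of poles. -/
theorem exists_alternating_numerator (hΨ : R.IsBase Ψ) {l : List (Fin n → ℝ)}
    (hl : ∀ x ∈ l, x ∈ R.simples Ψ K) (hlen : l.length = (R.posRootsOf Ψ K).card) :
    ∃ c : (Cn n ≃ₗ[ℂ] Cn n) → ℂ,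
      (∀ g ∈ K, wordCoeff R.refl R.gammaMer l g = algebraMap ℂ (Mer n) (c g) / R.delta Ψ K) ∧
      ∀ x ∈ R.simples Ψ K, ∀ g ∈ K, c (R.refl x * g) = -c g := by
  obtain ⟨P, hP, hc⟩ := exists_isNumerator hΨ hl
  have hconst : ∀ g ∈ K, P g = C ((P g).coeff 0) := by
    intro g hg
    rw [← totalDegree_eq_zero_iff_eq_C]
    by_cases h : P g = 0
    · rw [h, totalDegree_zero]
    · have := hP.1 g hg h
      omega
  refine ⟨fun g => (P g).coeff 0, fun g hg => ?_, fun x hx g hg => ?_⟩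
  · rw [hc g hg, ← polyMer_C, ← hconst g hg]
  · have hxK : x ∈ R.posRootsOf Ψ K := mem_posRootsOf.2 ⟨hΨ.mem_posRoots hx.1, hx.2⟩
    obtain ⟨Q, hQ⟩ := hP.2 g hg x hxK
    have hγ := gammaPoly_ne_zero (hΨ.1 hx.1)
    have hQ0 : Q = 0 := by
      by_contra h
      have h1 := congrArg totalDegree hQ
      rw [totalDegree_mul_of_isDomain hγ h, hconst g hg, hconst _ (K.mul_mem hx.2 hg), ← C_add,
        totalDegree_C, gammaPoly, totalDegree_linPoly (gammaLin_ne_zero (hΨ.1 hx.1))] at h1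
      omega
    rw [hQ0, mul_zero] at hQ
    change (P (R.refl x * g)).coeff 0 = -(P g).coeff 0
    rw [(neg_eq_of_add_eq_zero_right hQ).symm, coeff_neg]

/-- A word as long as the number of positive roots is a multiple of the antisymmetrization
`∑ g ∘ Δ_K⁻¹`. -/
theorem exists_wordCoeff_eq (hΨ : R.IsBase Ψ) (hK : R.IsParabolic Ψ K) {l : List (Fin n → ℝ)}
    (hl : ∀ x ∈ l, x ∈ R.simples Ψ K) (hlen : l.length = (R.posRootsOf Ψ K).card) :
    ∃ κ : ℂ, ∀ g ∈ K, wordCoeff R.refl R.gammaMer l g =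
      algebraMap ℂ (Mer n) κ / (g • R.delta Ψ K) := by
  obtain ⟨c, hc, halt⟩ := exists_alternating_numerator hΨ hl hlen
  have hΔ := delta_ne_zero (R := R) (Ψ := Ψ) K
  have hmain : ∀ g ∈ K, algebraMap ℂ (Mer n) (c g) * g • R.delta Ψ K =
      algebraMap ℂ (Mer n) (c 1) * R.delta Ψ K := by
    intro g hg
    refine hK.induction (p := fun g => algebraMap ℂ (Mer n) (c g) * g • R.delta Ψ K =
      algebraMap ℂ (Mer n) (c 1) * R.delta Ψ K) ?_ (fun x hx g hg ih => ?_) hg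
    · exact congrArg _ (one_smul (Cn n ≃ₗ[ℂ] Cn n) (R.delta Ψ K))
    · have h1 := congrArg (fun f => R.refl x • f) ih
      rw [smul_mul', smul_mul', smul_delta hΨ hx, ← mul_smul, smul_algebraMap,
        smul_algebraMap] at h1
      rw [halt x hx g hg, RingHom.map_neg, neg_mul, h1, mul_neg, neg_neg]
  refine ⟨c 1, fun g hg => ?_⟩
  rw [hc g hg]
  exact (div_eq_div_iff hΔ (smul_mer_ne_zero g hΔ)).2 (hmain g hg)

/-- Of the elements at least as long as a word, only its product can occur in the expansion. -/
theorem eq_or_len_lt_of_wordCoeff_ne_zero {l : List (Fin n → ℝ)} (hl : ∀ x ∈ l, x ∈ Ψ)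
    (h : wordCoeff R.refl R.gammaMer l g ≠ 0) :
    g = (l.map R.refl).prod ∨ R.len Ψ g < l.length := by
  obtain ⟨l', hl', hg⟩ := exists_sublist_of_wordCoeff_ne_zero h
  have h1 := IsExpr.len_le (R := R) (Ψ := Ψ) ⟨fun x hx => hl x (hl'.subset hx), hg⟩
  rcases hl'.length_le.lt_or_eq with h2 | h2
  · exact Or.inr (h1.trans_lt h2)
  · rw [hl'.eq_of_length h2] at hg
    exact Or.inl hg.symm

theorem wordCoeff_ne_zero (hΨ : R.IsBase Ψ) {l : List (Fin n → ℝ)} (hl : R.IsReducedExpr Ψ g l) :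
    wordCoeff R.refl R.gammaMer l g ≠ 0 := by
  induction l generalizing g with
  | nil =>
    rw [show g = 1 by simpa using hl.1.2.symm, wordCoeff_nil_one]
    exact one_ne_zero
  | cons x l ih =>
    obtain ⟨⟨hl, rfl⟩, hlen⟩ := hl
    have hx : x ∈ Ψ := hl x (by simp)
    have hl' : ∀ y ∈ l, y ∈ Ψ := fun y hy => hl y (by simp [hy])
    rw [List.map_cons, List.prod_cons, List.length_cons] at hlen
    rw [List.map_cons, List.prod_cons, wordCoeff_cons, refl_inv, refl_mul_refl_mul]
    have hsub : ∀ l : List (Fin n → ℝ), (∀ y ∈ l, y ∈ Ψ) →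
        R.len Ψ (l.map R.refl).prod ≤ l.length := fun l hl => IsExpr.len_le ⟨hl, rfl⟩
    have h0 : wordCoeff R.refl R.gammaMer l (R.refl x * (l.map R.refl).prod) = 0 := by
      by_contra h
      rcases eq_or_len_lt_of_wordCoeff_ne_zero hl' h with h1 | h1
      · rw [h1] at hlen
        have := hsub l hl'
        omega
      · omega
    have hred : R.IsReducedExpr Ψ (l.map R.refl).prod l := by
      refine ⟨⟨hl', rfl⟩, le_antisymm ?_ (hsub l hl')⟩
      have h1 := hΨ.len_mul_le (hΨ.group_of_simple hx) (hΨ.word_mem_group hl')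
      have h2 := hsub [x] (by simpa using hx)
      simp only [List.map_cons, List.map_nil, List.prod_cons, List.prod_nil, mul_one,
        List.length_singleton] at h2
      omega
    rw [h0, zero_sub]
    exact mul_ne_zero (inv_ne_zero (gammaMer_ne_zero (hΨ.1 hx)))
      (neg_ne_zero.2 (smul_mer_ne_zero _ (ih hred)))

/-- No element of `K` is longer than the number of positive roots of `K`. -/
theorem len_le_card (hΨ : R.IsBase Ψ) (hK : R.IsParabolic Ψ K) (hg : g ∈ K) :
    R.len Ψ g ≤ (R.posRootsOf Ψ K).card := by
  obtain ⟨l, hl⟩ := hΨ.exists_isReducedExpr (hK.le_group hΨ hg)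
  rw [← hl.2]
  by_contra! h
  exact wordCoeff_ne_zero hΨ hl
    (wordCoeff_eq_zero hΨ (hΨ.reduced_subset_simples hK hg hl) h hg)

end RootSys

end Numerators

/-! ### Divided differences of invariant germs -/

section Core

/-- `𝔐` as a vector space over the field of meromorphic functions. -/
@[reducible] def germModule : Module (Mer n) (MerGerms n) where
  smul f F := mulOp f F
  one_smul := mulOp_one
  mul_smul := mulOp_mul
  smul_zero f := (mulOp f).map_zero
  smul_add f := (mulOp f).map_add
  add_smul := mulOp_add
  zero_smul := mulOp_zero

/-- The action of `GL(V)` on `𝔐`. -/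
@[reducible] def germAction : DistribMulAction (Cn n ≃ₗ[ℂ] Cn n) (MerGerms n) where
  smul g F := pushOp g.toAffineEquiv F
  one_smul := pushOp_linear_one
  mul_smul := pushOp_linear_mul
  smul_zero g := (pushOp g.toAffineEquiv).map_zero
  smul_add g := (pushOp g.toAffineEquiv).map_add

attribute [local instance] merAction

-- Shortcuts that keep instance search short.
local instance : Module ℂ (MerGerms n) := inferInstance
local instance : DistribMulAction ℂ (MerGerms n) := Module.toDistribMulAction
local instance : DistribSMul ℂ (MerGerms n) := DistribMulAction.toDistribSMul

namespace RootSys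

variable {R : RootSys n} {g h : Cn n ≃ₗ[ℂ] Cn n} {Ψ : Finset (Fin n → ℝ)}
  {K H : Subgroup (Cn n ≃ₗ[ℂ] Cn n)}

theorem prod_divDiffRoot_eq_sum [Fintype K] {l : List (Fin n → ℝ)}
    (hl : ∀ x ∈ l, x ∈ R.simples Ψ K) (F : MerGerms n) :
    (l.map R.divDiffRoot).prod F =
      ∑ g : K, mulOp (wordCoeff R.refl R.gammaMer l (g : Cn n ≃ₗ[ℂ] Cn n))
        (pushOp (g : Cn n ≃ₗ[ℂ] Cn n).toAffineEquiv F) := by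
  let _ := germModule (n := n)
  let _ := germAction (n := n)
  have h1 : ∀ l : List (Fin n → ℝ), (l.map R.divDiffRoot).prod F = l.foldr (fun x b =>
      mulOp (R.gammaMer x)⁻¹ (b - pushOp (R.refl x).toAffineEquiv b)) F := by
    intro l
    induction l with
    | nil => rfl
    | cons x l ih =>
      rw [List.foldr_cons, ← ih]
      rfl
  rw [h1]
  exact foldr_divDiff_eq_sum (fun g m a => pushOp_mulOp g.toAffineEquiv m a) K
    (fun x hx => (hl x hx).2) F

theorem exists_divDiff_eq (hΨ : R.IsBase Ψ) (hg : g ∈ R.group) :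
    ∃ l, R.IsReducedExpr Ψ g l ∧ R.divDiff Ψ g = (l.map R.divDiffRoot).prod := by
  have h := hΨ.exists_isReducedExpr hg
  exact ⟨h.choose, h.choose_spec, dif_pos h⟩

/-- Every coset `g H` contains a shortest element. -/
theorem exists_isShort (hHK : H ≤ K) (hg : g ∈ K) : ∃ h ∈ H, R.IsShort Ψ K H (g * h) := by
  obtain ⟨h, hh, hlen⟩ := Nat.sInf_mem
    (⟨_, 1, H.one_mem, rfl⟩ : Set.Nonempty {k | ∃ h ∈ H, R.len Ψ (g * h) = k})
  refine ⟨h, hh, K.mul_mem hg (hHK hh), fun h' hh' => ?_⟩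
  rw [hlen, mul_assoc]
  exact Nat.sInf_le ⟨_, H.mul_mem hh hh', rfl⟩

theorem IsLongestShort.card_le (hΨ : R.IsBase Ψ) (hK : R.IsParabolic Ψ K)
    (hH : R.IsParabolic Ψ H) (hHK : H ≤ K) (hw : R.IsLongestShort Ψ K H g) :
    (R.posRootsOf Ψ K).card ≤ R.len Ψ g + (R.posRootsOf Ψ H).card := by
  obtain ⟨w, hwK, hw1⟩ := hΨ.exists_long hK
  obtain ⟨h, hh, hshort⟩ := exists_isShort (R := R) (Ψ := Ψ) hHK hwK
  have h1 := hw.2 _ hshort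
  have h2 := len_le_card hΨ hH (H.inv_mem hh)
  have h3 := hΨ.len_mul_le (hK.le_group hΨ hshort.1) (hH.le_group hΨ (H.inv_mem hh))
  rw [mul_inv_cancel_right] at h3
  omega

/-- Let `l` be a reduced expression of a shortest element `w` of `w H`, and `l₀` a word of `H`. In
the expansion of the word `l ++ l₀`, the element `w` comes only from `w` and `1`. -/
theorem IsShort.wordCoeff_append_eq [Fintype K]
    {l l₀ : List (Fin n → ℝ)} (hl : ∀ x ∈ l, x ∈ R.simples Ψ K)
    (hl₀ : ∀ x ∈ l₀, x ∈ R.simples Ψ H) (hred : R.IsReducedExpr Ψ g l)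
    (hg : R.IsShort Ψ K H g) :
    wordCoeff R.refl R.gammaMer (l ++ l₀) g =
      wordCoeff R.refl R.gammaMer l g * g • wordCoeff R.refl R.gammaMer l₀ 1 := by
  rw [wordCoeff_append K (fun x hx => (hl x hx).2), Finset.sum_eq_single ⟨g, hg.1⟩]
  · rw [inv_mul_cancel]
  · intro h _ hne
    by_contra h0
    obtain ⟨l', hl', hprod⟩ := exists_sublist_of_wordCoeff_ne_zero
      (s := R.refl) (γ := R.gammaMer) (l := l₀) (g := (h : Cn n ≃ₗ[ℂ] Cn n)⁻¹ * g) (fun h1 =>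
        h0 (by rw [h1]; exact (congrArg _ (smul_zero _)).trans (mul_zero _)))
    have hmem : (h : Cn n ≃ₗ[ℂ] Cn n)⁻¹ * g ∈ H := by
      rw [← hprod]
      refine H.list_prod_mem fun y hy => ?_
      obtain ⟨x, hx, rfl⟩ := List.mem_map.1 hy
      exact (hl₀ x (hl'.subset hx)).2
    have hlen := hg.2 _ (H.inv_mem hmem)
    rw [mul_inv_rev, inv_inv, mul_inv_cancel_left] at hlen
    rcases eq_or_len_lt_of_wordCoeff_ne_zero (fun x hx => (hl x hx).1)
      (left_ne_zero_of_mul h0) with h1 | h1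
    · exact hne (Subtype.ext (h1.trans hred.1.2))
    · rw [hred.2] at h1
      omega
  · simp

/-- Parabolic subgroups have words of maximal length whose divided difference is a nonzero multiple
of the antisymmetrization. -/
theorem exists_long_word (hΨ : R.IsBase Ψ) (hH : R.IsParabolic Ψ H) :
    ∃ l : List (Fin n → ℝ), (∀ x ∈ l, x ∈ R.simples Ψ H) ∧
      l.length = (R.posRootsOf Ψ H).card ∧ ∃ κ : ℂ, κ ≠ 0 ∧ ∀ h ∈ H,
        wordCoeff R.refl R.gammaMer l h = algebraMap ℂ (Mer n) κ / (h • R.delta Ψ H) := by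
  obtain ⟨w, hw, hlen⟩ := hΨ.exists_long hH
  obtain ⟨l, hl⟩ := hΨ.exists_isReducedExpr (hH.le_group hΨ hw)
  have hlH := hΨ.reduced_subset_simples hH hw hl
  have hcard : l.length = (R.posRootsOf Ψ H).card := by
    rw [hl.2]
    exact le_antisymm (len_le_card hΨ hH hw) hlen
  obtain ⟨κ, hκ⟩ := exists_wordCoeff_eq hΨ hH hlH hcard
  refine ⟨l, hlH, hcard, κ, fun h0 => wordCoeff_ne_zero hΨ hl ?_, hκ⟩
  rw [hκ w hw, h0, RingHom.map_zero, zero_div]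

/-- An antisymmetrizing word acts on `Δ_H F`, for `F` any germ, by symmetrizing `(Δ_H / Δ_K) F`. -/
theorem prod_divDiffRoot_delta [Fintype K] {l : List (Fin n → ℝ)}
    (hl : ∀ x ∈ l, x ∈ R.simples Ψ K) {κ : ℂ} (hκ : ∀ g ∈ K,
      wordCoeff R.refl R.gammaMer l g = algebraMap ℂ (Mer n) κ / (g • R.delta Ψ K))
    (F : MerGerms n) :
    (l.map R.divDiffRoot).prod (mulOp (R.delta Ψ H) F) =
      κ • ∑ g : K, pushOp (g : Cn n ≃ₗ[ℂ] Cn n).toAffineEquiv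
        (mulOp (R.delta Ψ H / R.delta Ψ K) F) := by
  rw [prod_divDiffRoot_eq_sum hl, Finset.smul_sum]
  refine Finset.sum_congr rfl fun g _ => ?_
  rw [pushOp_mulOp, pushOp_mulOp, ← mulOp_mul, ← mulOp_algebraMap, ← mulOp_mul, hκ g g.2]
  congr 2
  rw [map_div₀]
  exact (div_mul_eq_mul_div _ _ _).trans (mul_div_assoc _ _ _)

/-- On germs invariant under `H`, the divided difference of the longest shortest representative
is a nonzero multiple of the symmetrization of `(Δ_H / Δ_K) F` over `K`. -/
theorem IsLongestShort.exists_sum_eq_smul_divDiff (hΨ : R.IsBase Ψ) (hK : R.IsParabolic Ψ K)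
    (hH : R.IsParabolic Ψ H) (hHK : H ≤ K) [Fintype K] (hw : R.IsLongestShort Ψ K H g) :
    ∃ a : ℂ, a ≠ 0 ∧ ∀ F : MerGerms n, (∀ h ∈ H, pushOp h.toAffineEquiv F = F) →
      ∑ k : K, pushOp (k : Cn n ≃ₗ[ℂ] Cn n).toAffineEquiv
        (mulOp (R.delta Ψ H / R.delta Ψ K) F) = a • R.divDiff Ψ g F := by
  classical
  have hHfin : Finite H := Finite.of_injective _ (Subgroup.inclusion_injective hHK)
  let _ : Fintype H := Fintype.ofFinite H
  obtain ⟨l, hl, hdiv⟩ := exists_divDiff_eq hΨ (hK.le_group hΨ hw.1.1)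
  have hlK := hΨ.reduced_subset_simples hK hw.1.1 hl
  obtain ⟨l₀, hl₀, hlen₀, κ₀, hκ₀, hc₀⟩ := exists_long_word hΨ hH
  have hl₀K : ∀ x ∈ l ++ l₀, x ∈ R.simples Ψ K := by
    intro x hx
    rcases List.mem_append.1 hx with hx | hx
    · exact hlK x hx
    · exact ⟨(hl₀ x hx).1, hHK (hl₀ x hx).2⟩
  -- The word `l ++ l₀` does not vanish, as its coefficient at `g` does not.
  have hne : wordCoeff R.refl R.gammaMer (l ++ l₀) g ≠ 0 := by
    rw [hw.1.wordCoeff_append_eq hlK hl₀ hl]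
    refine mul_ne_zero (wordCoeff_ne_zero hΨ hl) (smul_mer_ne_zero g ?_)
    rw [hc₀ 1 H.one_mem]
    refine div_ne_zero (fun h0 => hκ₀ ?_) (smul_mer_ne_zero 1 (delta_ne_zero H))
    exact (algebraMap ℂ (Mer n)).injective (h0.trans (RingHom.map_zero _).symm)
  have hlen : (l ++ l₀).length = (R.posRootsOf Ψ K).card := by
    refine le_antisymm ?_ ?_
    · by_contra! h
      exact hne (wordCoeff_eq_zero hΨ hl₀K h hw.1.1)
    · rw [List.length_append, hlen₀, hl.2]
      exact hw.card_le hΨ hK hH hHK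
  obtain ⟨κ, hκ⟩ := exists_wordCoeff_eq hΨ hK hl₀K hlen
  have hκ0 : κ ≠ 0 := by
    intro h0
    refine hne ?_
    rw [hκ g hw.1.1, h0, RingHom.map_zero, zero_div]
  have hcard : ((Fintype.card H : ℕ) : ℂ) ≠ 0 := Nat.cast_ne_zero.2 Fintype.card_ne_zero
  refine ⟨κ⁻¹ * (κ₀ * Fintype.card H), mul_ne_zero (inv_ne_zero hκ0) (mul_ne_zero hκ₀ hcard),
    fun F hF => ?_⟩
  -- The word `l₀` turns `Δ_H F` into a multiple of the invariant germ `F`.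
  have h1 : (l₀.map R.divDiffRoot).prod (mulOp (R.delta Ψ H) F) =
      (κ₀ * Fintype.card H : ℂ) • F := by
    rw [prod_divDiffRoot_delta hl₀ hc₀, div_self (delta_ne_zero H), mulOp_one, mul_smul]
    congr 1
    rw [Finset.sum_congr rfl fun (h : H) _ => hF h h.2, Finset.sum_const, Finset.card_univ,
      Nat.cast_smul_eq_nsmul]
  have h2 := prod_divDiffRoot_delta (H := H) hl₀K hκ F
  rw [List.map_append, List.prod_append, Module.End.mul_apply, h1, LinearMap.map_smul] at h2
  rw [hdiv, mul_smul, h2, smul_smul, inv_mul_cancel₀ hκ0, one_smul]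

end RootSys

end Core

/-! ### Regular and rational functions -/

section Regular

open MvPolynomial

theorem RegularAt.mul {f g : Mer n} {x : Cn n} (hf : RegularAt f x) (hg : RegularAt g x) :
    RegularAt (f * g) x := by
  obtain ⟨a, ha⟩ := hf
  obtain ⟨b, hb⟩ := hg
  exact ⟨a * b, by rw [RingHom.map_mul, RingHom.map_mul, ha, hb]⟩

theorem regularAt_algebraMap (f : Hol n) (x : Cn n) :
    RegularAt (algebraMap (Hol n) (Mer n) f) x :=
  ⟨germHol x f, (germMer_algebraMap x f).symm⟩

/-- The reciprocal of an entire function is regular where the function does not vanish. -/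
theorem regularAt_inv {f : Hol n} {x : Cn n} (hf : (f : Cn n → ℂ) x ≠ 0) :
    RegularAt (algebraMap (Hol n) (Mer n) f)⁻¹ x := by
  let u : HolGerm x := ⟨((fun y => ((f : Cn n → ℂ) y)⁻¹ : Cn n → ℂ) : Germ (𝓝 x) ℂ), _,
    (f.2 x).inv hf, rfl⟩
  have hu : germHol x f * u = 1 := by
    refine Subtype.ext (Germ.coe_eq.2 ?_)
    filter_upwards [(f.2 x).continuousAt.eventually_ne hf] with y hy
    exact mul_inv_cancel₀ hy
  refine ⟨u, ?_⟩
  rw [map_inv₀, germMer_algebraMap]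
  refine eq_inv_of_mul_eq_one_right ?_
  rw [← RingHom.map_mul, hu, RingHom.map_one]

theorem isRational_polyMer_div (P : MvPolynomial (Fin n) ℂ) {Q : MvPolynomial (Fin n) ℂ}
    (hQ : Q ≠ 0) : IsRational (polyMer (n := n) P / polyMer (n := n) Q) := ⟨P, Q, hQ, rfl⟩

end Regular

/-! ### Sums over an orbit -/

namespace RootSys

open MvPolynomial

variable {R : RootSys n} {g τ : Cn n ≃ₗ[ℂ] Cn n} {Ψ : Finset (Fin n → ℝ)}
  {K H : Subgroup (Cn n ≃ₗ[ℂ] Cn n)} {v : Cn n}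

/-- On invariant germs, the operator of the orbit sum symmetrizes `(Δ' / Δ) p φ_v F`. -/
theorem orbitSum_op (p : Hol n) {F : MerGerms n} (hF : F ∈ invHolGerms R.group) :
    (R.orbitSum Ψ v p).op F = ∑ g : R.group, pushOp (g : Cn n ≃ₗ[ℂ] Cn n).toAffineEquiv
      (mulOp (R.delta Ψ (stab R.group v) / R.delta Ψ R.group)
        (mulOp (algebraMap (Hol n) (Mer n) p) (pushOp (translation v) F))) := by
  rw [orbitSum, Skew.op_sum]
  refine Finset.sum_congr rfl fun g _ => ?_
  rw [Skew.act_single, Skew.op_single]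
  conv_lhs => rw [← hF.2 g g.2]
  rw [pushOp_translation, ← pushOp_mulOp, mulOp_mul]

theorem pushOp_mulOp_translation {F : MerGerms n} (hF : F ∈ invHolGerms R.group)
    (hg : g ∈ R.group) (f : Mer n) (u : Cn n) :
    pushOp g.toAffineEquiv (mulOp f (pushOp (translation u) F)) =
      mulOp (pushMer g.toAffineEquiv f) (pushOp (translation (g u)) F) := by
  rw [pushOp_mulOp, ← pushOp_translation, hF.2 g hg]

/-- Transport by `τ` changes a product of linear forms of positive roots by a sign. -/
theorem exists_pushPoly_deltaPoly (hΨ : R.IsBase Ψ) (hτ : τ ∈ R.group)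
    (hHK : ∀ y ∈ R.roots, R.refl y ∈ H ↔ R.refl (ract τ y) ∈ K) :
    ∃ c : ℂ, c ≠ 0 ∧ pushPoly τ (R.deltaPoly Ψ H) = C c * R.deltaPoly Ψ K := by
  classical
  let pos : (Fin n → ℝ) → Fin n → ℝ := fun y => if y ∈ R.posRoots Ψ then y else -y
  let e : (Fin n → ℝ) → ℂ := fun y => if y ∈ R.posRoots Ψ then 1 else -1
  have hpos : ∀ y ∈ R.roots, pos y ∈ R.posRoots Ψ := by
    intro y hy
    by_cases h : y ∈ R.posRoots Ψ
    · simpa only [pos, if_pos h] using h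
    · simpa only [pos, if_neg h] using (hΨ.pos_or_neg hy).resolve_left h
  have hrefl : ∀ y, R.refl (pos y) = R.refl y := by
    intro y
    by_cases h : y ∈ R.posRoots Ψ
    · simp only [pos, if_pos h]
    · simp only [pos, if_neg h, refl_neg]
  have hgamma : ∀ y, R.gammaPoly y = C (e y) * R.gammaPoly (pos y) := by
    intro y
    by_cases h : y ∈ R.posRoots Ψ
    · simp only [pos, e, if_pos h, C_1, one_mul]
    · simp only [pos, e, if_neg h, gammaPoly_neg, C_neg, C_1]
      ring
  have hinv : ∀ {σ : Cn n ≃ₗ[ℂ] Cn n}, σ ∈ R.group → ∀ y ∈ R.posRoots Ψ,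
      pos (ract σ⁻¹ (pos (ract σ y))) = y := by
    intro σ hσ y hy
    by_cases h : ract σ y ∈ R.posRoots Ψ
    · simp only [pos, if_pos h, ract_inv_ract hσ, if_pos hy]
    · simp only [pos, if_neg h, ract_neg, ract_inv_ract hσ, if_neg (hΨ.neg_notMem_posRoots hy),
        neg_neg]
  have hτ' := R.group.inv_mem hτ
  refine ⟨∏ y ∈ R.posRootsOf Ψ H, e (ract τ y), Finset.prod_ne_zero_iff.2 fun y _ => ?_, ?_⟩
  · by_cases h : ract τ y ∈ R.posRoots Ψ
    · simp only [e, if_pos h]; exact one_ne_zero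
    · simp only [e, if_neg h]; exact neg_ne_zero.2 one_ne_zero
  · rw [deltaPoly, map_prod, map_prod, deltaPoly,
      Finset.prod_congr rfl fun y _ => (pushPoly_gammaPoly hτ y).trans (hgamma _),
      Finset.prod_mul_distrib]
    refine congrArg (HMul.hMul _) ?_
    refine Finset.prod_nbij' (fun y => pos (ract τ y)) (fun y => pos (ract τ⁻¹ y))
      (fun y hy => ?_) (fun y hy => ?_) (fun y hy => hinv hτ y (mem_posRootsOf.1 hy).1)
      (fun y hy => ?_) (fun y _ => rfl)
    · obtain ⟨h1, h2⟩ := mem_posRootsOf.1 hy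
      refine mem_posRootsOf.2 ⟨hpos _ (ract_mem_roots hτ (roots_of_posRoots h1)), ?_⟩
      rw [hrefl]
      exact (hHK y (roots_of_posRoots h1)).1 h2
    · obtain ⟨h1, h2⟩ := mem_posRootsOf.1 hy
      have h3 := ract_mem_roots hτ' (roots_of_posRoots h1)
      refine mem_posRootsOf.2 ⟨hpos _ h3, ?_⟩
      rw [hrefl, hHK _ h3, ract_ract_inv hτ]
      exact h2
    · have := hinv hτ' y (mem_posRootsOf.1 hy).1
      rwa [inv_inv] at this

/-! ### The poles of the coefficients -/

variable (R Ψ) in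
open Classical in
/-- The product of the linear forms of the positive roots whose reflections neither lie in `K` nor
fix `u`. -/
def polePoly (K : Subgroup (Cn n ≃ₗ[ℂ] Cn n)) (u : Cn n) : MvPolynomial (Fin n) ℂ :=
  ∏ y ∈ (R.posRoots Ψ).filter (fun y => R.refl y ∉ K ∧ R.refl y u ≠ u), R.gammaPoly y

theorem polePoly_ne_zero (u : Cn n) : R.polePoly Ψ K u ≠ 0 := by
  classical
  exact Finset.prod_ne_zero_iff.2 fun _ hx =>
    gammaPoly_ne_zero (roots_of_posRoots (Finset.mem_filter.1 hx).1)

theorem eval_polePoly_ne_zero {u x : Cn n}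
    (hx : ∀ y ∈ R.posRoots Ψ, R.refl y ∉ K → R.gammaLin y x ≠ 0) :
    eval x (R.polePoly Ψ K u) ≠ 0 := by
  classical
  rw [polePoly, map_prod]
  refine Finset.prod_ne_zero_iff.2 fun y hy => ?_
  obtain ⟨h1, h2, -⟩ := Finset.mem_filter.1 hy
  rw [eval_gammaPoly]
  exact hx y h1 h2

/-- Inclusion and exclusion for the roots of `K` and of the stabilizer of `u`. -/
theorem polePoly_mul (u : Cn n) :
    R.deltaPoly Ψ (stab R.group u) * R.deltaPoly Ψ K * R.polePoly Ψ K u =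
      R.deltaPoly Ψ R.group * R.deltaPoly Ψ (stab K u) := by
  classical
  simp only [deltaPoly, polePoly, posRootsOf, Finset.prod_filter, ← Finset.prod_mul_distrib]
  refine Finset.prod_congr rfl fun y hy => ?_
  have hG : R.refl y ∈ R.group := R.refl_mem_group (roots_of_posRoots hy)
  by_cases h1 : R.refl y ∈ K <;> by_cases h2 : R.refl y u = u <;>
    simp [mem_stab, hG, h1, h2]

/-- The stabilizer of `u` in `K`, if parabolic, permutes the factors of the pole polynomial. -/
theorem pushPoly_polePoly (hΨ : R.IsBase Ψ) {u : Cn n}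
    (hH : R.IsParabolic Ψ (stab K u)) (hg : g ∈ stab K u) :
    pushPoly g (R.polePoly Ψ K u) = R.polePoly Ψ K u := by
  classical
  refine hH.induction (p := fun g => pushPoly g (R.polePoly Ψ K u) = R.polePoly Ψ K u)
    (pushPoly_one _) (fun x hx g _ ih => ?_) hg
  obtain ⟨hxK, hxu⟩ := mem_stab.1 hx.2
  have hxG := hΨ.group_of_simple hx.1
  have hinv := R.realRefl_realRefl (R.anisotropic x (hΨ.1 hx.1))
  have hmaps : ∀ y ∈ (R.posRoots Ψ).filter (fun y => R.refl y ∉ K ∧ R.refl y u ≠ u),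
      R.realRefl x y ∈ (R.posRoots Ψ).filter (fun y => R.refl y ∉ K ∧ R.refl y u ≠ u) := by
    intro y hy
    obtain ⟨h1, h2, h3⟩ := Finset.mem_filter.1 hy
    have hconj : R.refl (R.realRefl x y) = R.refl x * R.refl y * R.refl x := by
      rw [← ract_refl, refl_ract hxG, refl_inv]
    refine Finset.mem_filter.2 ⟨hΨ.realRefl_pos hx.1 h1 ?_, fun h => h2 ?_, fun h => h3 ?_⟩
    · rintro rfl
      exact h2 hxK
    · have h4 := K.mul_mem (K.mul_mem hxK h) hxK
      rwa [hconj, mul_assoc, mul_assoc, mul_assoc, refl_mul_self, mul_one,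
        refl_mul_refl_mul] at h4
    · rw [hconj, LinearEquiv.mul_apply, LinearEquiv.mul_apply, hxu] at h
      have h4 := congrArg (R.refl x) h
      rwa [hxu, ← LinearEquiv.mul_apply, refl_mul_self] at h4
  rw [pushPoly_mul, ih, polePoly, map_prod]
  refine Finset.prod_nbij' (R.realRefl x) (R.realRefl x) hmaps hmaps (fun y _ => hinv y)
    (fun y _ => hinv y) fun y _ => ?_
  rw [pushPoly_gammaPoly hxG, ract_refl]

/-- The polynomial identity behind `exists_pushMer_delta_div`, with denominators cleared. -/
theorem exists_pushPoly_deltaPoly_mul (hΨ : R.IsBase Ψ) (hτ : τ ∈ R.group)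
    (K : Subgroup (Cn n ≃ₗ[ℂ] Cn n)) (v : Cn n) :
    ∃ c : ℂ, pushPoly τ (R.deltaPoly Ψ (stab R.group v)) *
        (R.deltaPoly Ψ K * R.polePoly Ψ K (τ v)) =
      R.deltaPoly Ψ (stab K (τ v)) * C c * pushPoly τ (R.deltaPoly Ψ R.group) := by
  obtain ⟨c₁, -, h₁⟩ := exists_pushPoly_deltaPoly (τ := τ) (H := stab R.group v)
    (K := stab R.group (τ v)) hΨ hτ fun y hy => by
      have hy1 := R.refl_mem_group hy
      have hy2 := R.refl_mem_group (ract_mem_roots hτ hy)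
      have h : R.refl (ract τ y) (τ v) = τ (R.refl y v) := by
        rw [refl_ract hτ, LinearEquiv.mul_apply, LinearEquiv.mul_apply]
        exact congrArg (fun z => τ (R.refl y z)) (τ.symm_apply_apply v)
      rw [mem_stab, mem_stab, h, τ.injective.eq_iff]
      exact ⟨fun h => ⟨hy2, h.2⟩, fun h => ⟨hy1, h.2⟩⟩
  obtain ⟨c₂, hc₂, h₂⟩ := exists_pushPoly_deltaPoly (τ := τ) (H := R.group)
    (K := R.group) hΨ hτ fun y hy =>
      ⟨fun _ => R.refl_mem_group (ract_mem_roots hτ hy), fun _ => R.refl_mem_group hy⟩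
  have h₃ := polePoly_mul (R := R) (Ψ := Ψ) (K := K) (τ v)
  have hC : (C c₁ : MvPolynomial (Fin n) ℂ) = C c₂ * C (c₁ / c₂) := by
    rw [← C_mul, mul_div_cancel₀ _ hc₂]
  refine ⟨c₁ / c₂, ?_⟩
  rw [h₁, h₂, hC]
  linear_combination (C c₂ * C (c₁ / c₂)) * h₃

/-- Up to a constant, `τ · (Δ' / Δ)` is `Δ_H / Δ_K` over the pole polynomial, where `H` is the
stabilizer of `τ v` in `K`. -/
theorem exists_pushMer_delta_div (hΨ : R.IsBase Ψ) (hτ : τ ∈ R.group)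
    (K : Subgroup (Cn n ≃ₗ[ℂ] Cn n)) (v : Cn n) :
    ∃ c : ℂ, pushMer (n := n) τ.toAffineEquiv (R.delta Ψ (stab R.group v) / R.delta Ψ R.group) =
      R.delta Ψ (stab K (τ v)) / R.delta Ψ K *
        (polyMer (n := n) (C c) / polyMer (n := n) (R.polePoly Ψ K (τ v))) := by
  obtain ⟨c, hc⟩ := exists_pushPoly_deltaPoly_mul hΨ hτ K v
  refine ⟨c, ?_⟩
  have hB : polyMer (n := n) (pushPoly (n := n) τ (R.deltaPoly Ψ R.group)) ≠ 0 := by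
    rw [← pushMer_polyMer]
    exact smul_mer_ne_zero τ (polyMer_ne_zero (deltaPoly_ne_zero _))
  have hD : polyMer (n := n) (R.deltaPoly Ψ K * R.polePoly Ψ K (τ v)) ≠ 0 :=
    polyMer_ne_zero (mul_ne_zero (deltaPoly_ne_zero _) (polePoly_ne_zero _))
  simp only [← polyMer_deltaPoly]
  rw [pushMer_map_div, pushMer_polyMer, pushMer_polyMer, div_mul_div_comm, ← RingHom.map_mul,
    ← RingHom.map_mul]
  refine (div_eq_div_iff hB hD).2 ?_
  rw [← RingHom.map_mul, ← RingHom.map_mul, hc]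

/-! ### Cosets of a parabolic subgroup -/

/-- The coefficient attached to the coset `K τ` is invariant under the stabilizer of `τ v` in
`K`. -/
theorem pushMer_coset_coeff (hΨ : R.IsBase Ψ) (hK : K ≤ R.group) (hτ : τ ∈ R.group)
    (hH : R.IsParabolic Ψ (stab K (τ v)))
    {p : Hol n} (hp : ∀ h ∈ stab R.group v, pushHol (n := n) h.toAffineEquiv p = p) (c : ℂ)
    (hg : g ∈ stab K (τ v)) :
    pushMer (n := n) g.toAffineEquiv
      (polyMer (n := n) (C c) / polyMer (n := n) (R.polePoly Ψ K (τ v)) *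
        pushMer (n := n) τ.toAffineEquiv (algebraMap (Hol n) (Mer n) p)) =
    polyMer (n := n) (C c) / polyMer (n := n) (R.polePoly Ψ K (τ v)) *
      pushMer (n := n) τ.toAffineEquiv (algebraMap (Hol n) (Mer n) p) := by
  have h1 : τ⁻¹ * g * τ ∈ stab R.group v := by
    obtain ⟨hg1, hg2⟩ := mem_stab.1 hg
    refine mem_stab.2
      ⟨R.group.mul_mem (R.group.mul_mem (R.group.inv_mem hτ) (hK hg1)) hτ, ?_⟩
    rw [LinearEquiv.mul_apply, LinearEquiv.mul_apply, hg2]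
    exact τ.symm_apply_apply v
  have h2 : g * τ = τ * (τ⁻¹ * g * τ) := by group
  have h3 : pushPoly (n := n) g (C c) = C c := (pushPoly (n := n) g).commutes c
  rw [pushMer_map_mul, pushMer_map_div, pushMer_polyMer, pushMer_polyMer,
    pushPoly_polePoly hΨ hH hg, h3, ← pushMer_linear_mul, h2, pushMer_linear_mul, pushMer_algebraMap _ p, hp _ h1]

/-- The part of the orbit sum over a coset `K τ`. -/
theorem exists_coset_sum_eq (hΨ : R.IsBase Ψ) (hK : R.IsParabolic Ψ K) [Fintype K]
    (hτ : τ ∈ R.group) (hH : R.IsParabolic Ψ (stab K (τ v)))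
    {w : Cn n ≃ₗ[ℂ] Cn n} (hw : R.IsLongestShort Ψ K (stab K (τ v)) w)
    {p : Hol n} (hp : ∀ h ∈ stab R.group v, pushHol (n := n) h.toAffineEquiv p = p) :
    ∃ c : ℂ, ∀ F ∈ invHolGerms R.group,
      ∑ k : K, pushOp (n := n) ((k : Cn n ≃ₗ[ℂ] Cn n) * τ).toAffineEquiv
        (mulOp (n := n) (R.delta Ψ (stab R.group v) / R.delta Ψ R.group)
          (mulOp (n := n) (algebraMap (Hol n) (Mer n) p) (pushOp (n := n) (translation v) F))) =
      R.divDiff Ψ w (mulOp (n := n)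
        (polyMer (n := n) (C c) / polyMer (n := n) (R.polePoly Ψ K (τ v)) *
          pushMer (n := n) τ.toAffineEquiv (algebraMap (Hol n) (Mer n) p))
          (pushOp (n := n) (translation (τ v)) F)) := by
  have hKG := hK.le_group hΨ
  obtain ⟨c, hc⟩ := exists_pushMer_delta_div hΨ hτ K v
  obtain ⟨a, -, ha⟩ := hw.exists_sum_eq_smul_divDiff hΨ hK hH inf_le_left
  refine ⟨a * c, fun F hF => ?_⟩
  obtain ⟨f, hf⟩ : ∃ f : Mer n, polyMer (n := n) (C c) / polyMer (n := n) (R.polePoly Ψ K (τ v)) *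
    pushMer (n := n) τ.toAffineEquiv (algebraMap (Hol n) (Mer n) p) = f := ⟨_, rfl⟩
  have hfinv : ∀ h ∈ stab K (τ v), pushMer (n := n) h.toAffineEquiv f = f := fun h hh => by
    rw [← hf]
    exact pushMer_coset_coeff hΨ hKG hτ hH hp c hh
  have h1 := ha (mulOp (n := n) f (pushOp (n := n) (translation (τ v)) F)) fun h hh => by
    rw [pushOp_mulOp_translation hF (hKG (mem_stab.1 hh).1), hfinv h hh, (mem_stab.1 hh).2]
  rw [← LinearMap.map_smul, ← mulOp_algebraMap, ← mulOp_mul] at h1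
  have h2 : polyMer (n := n) (C (a * c)) / polyMer (n := n) (R.polePoly Ψ K (τ v)) *
      pushMer (n := n) τ.toAffineEquiv (algebraMap (Hol n) (Mer n) p) =
        algebraMap ℂ (Mer n) a * f := by
    rw [← hf, C_mul, RingHom.map_mul, polyMer_C a, mul_div_assoc, mul_assoc]
  rw [h2, mulOp_mul, ← h1]
  refine Finset.sum_congr rfl fun k _ => ?_
  rw [pushOp_linear_mul, ← mulOp_mul, pushOp_mulOp_translation hF hτ, pushMer_map_mul,
    hc, mul_assoc, hf, mulOp_mul]

/-- Representatives of the cosets `K \ G` whose inverses keep the simple roots of `K` positive. -/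
theorem exists_coset_reps (hΨ : R.IsBase Ψ) (K : Subgroup (Cn n ≃ₗ[ℂ] Cn n)) :
    ∃ (k : ℕ) (τ : Fin k → (Cn n ≃ₗ[ℂ] Cn n)), (∀ s, τ s ∈ R.group) ∧
      (∀ g ∈ R.group, ∃! s, g * (τ s)⁻¹ ∈ K) ∧
      ∀ s, ∀ x ∈ R.simples Ψ K, ract (τ s)⁻¹ x ∈ R.posRoots Ψ := by
  let r : Setoid R.group :=
    { r := fun a b => (a : Cn n ≃ₗ[ℂ] Cn n) * (b : Cn n ≃ₗ[ℂ] Cn n)⁻¹ ∈ K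
      iseqv :=
        { refl := fun a => by rw [mul_inv_cancel]; exact K.one_mem
          symm := fun {a b} h => by
            have := K.inv_mem h
            rwa [mul_inv_rev, inv_inv] at this
          trans := fun {a b c} h h' => by
            have := K.mul_mem h h'
            rwa [mul_assoc, inv_mul_cancel_left] at this } }
  obtain ⟨k, ⟨e⟩⟩ := Finite.exists_equiv_fin (Quotient r)
  choose τ hτ hcos hpos using fun q : Quotient r => hΨ.exists_coset_rep (K := K) q.out.2
  have hq : ∀ q : Quotient r, (⟦⟨τ q, hτ q⟩⟧ : Quotient r) = q := fun q => by
    conv_rhs => rw [← q.out_eq]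
    exact Quotient.sound (r.symm (hcos q))
  refine ⟨k, fun s => τ (e.symm s), fun s => hτ _, fun g hg => ?_, fun s => hpos _⟩
  refine ⟨e ⟦⟨g, hg⟩⟧, ?_, fun s hs => ?_⟩
  · have h1 : (⟦⟨g, hg⟩⟧ : Quotient r) = ⟦⟨τ ⟦⟨g, hg⟩⟧, hτ _⟩⟧ := (hq _).symm
    have h2 : r.r ⟨g, hg⟩ ⟨τ ⟦⟨g, hg⟩⟧, hτ _⟩ := Quotient.exact h1
    change g * (τ (e.symm (e ⟦⟨g, hg⟩⟧)))⁻¹ ∈ K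
    rw [e.symm_apply_apply]
    exact h2
  · have h1 : (⟦⟨g, hg⟩⟧ : Quotient r) = ⟦⟨τ (e.symm s), hτ _⟩⟧ := Quotient.sound hs
    rw [h1, hq, e.apply_symm_apply]

theorem sum_eq_sum_cosets {A : Type*} [AddCommMonoid A] (hK : K ≤ R.group) [Fintype K] {k : ℕ}
    {τ : Fin k → (Cn n ≃ₗ[ℂ] Cn n)} (hτ : ∀ s, τ s ∈ R.group)
    (hcos : ∀ g ∈ R.group, ∃! s, g * (τ s)⁻¹ ∈ K) (f : (Cn n ≃ₗ[ℂ] Cn n) → A) :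
    ∑ g : R.group, f g = ∑ s, ∑ h : K, f (h * τ s) := by
  rw [← Fintype.sum_prod_type' (f := fun s (h : K) => f (h * τ s))]
  refine (Fintype.sum_bijective (fun q : Fin k × K =>
    (⟨(q.2 : Cn n ≃ₗ[ℂ] Cn n) * τ q.1, R.group.mul_mem (hK q.2.2) (hτ q.1)⟩ : R.group))
    ⟨?_, ?_⟩ _ _ fun _ => rfl).symm
  · rintro ⟨s, h⟩ ⟨s', h'⟩ heq
    have heq : (h : Cn n ≃ₗ[ℂ] Cn n) * τ s = h' * τ s' := congrArg Subtype.val heq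
    have hs : s = s' := by
      refine (hcos _ (R.group.mul_mem (hK h.2) (hτ s))).unique ?_ ?_
      · rw [mul_inv_cancel_right]; exact h.2
      · rw [heq, mul_inv_cancel_right]; exact h'.2
    subst hs
    rw [Subtype.ext (mul_right_cancel heq)]
  · rintro ⟨g, hg⟩
    obtain ⟨s, hs, -⟩ := hcos g hg
    exact ⟨(s, ⟨_, hs⟩), Subtype.ext (inv_mul_cancel_right g (τ s))⟩

theorem exists_isLongestShort (hK : K ≤ R.group) (hHK : H ≤ K) :
    ∃ w, R.IsLongestShort Ψ K H w := by
  have : Finite K := Finite.of_injective _ (Subgroup.inclusion_injective hK)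
  have hfin : {w | R.IsShort Ψ K H w}.Finite :=
    (Set.toFinite (K : Set (Cn n ≃ₗ[ℂ] Cn n))).subset fun w hw => hw.1
  obtain ⟨h, -, hh⟩ := exists_isShort (R := R) (Ψ := Ψ) hHK K.one_mem
  obtain ⟨w, hw, hmax⟩ := hfin.exists_maximalFor (R.len Ψ) _ ⟨_, hh⟩
  exact ⟨w, hw, fun u hu => (le_total _ _).elim id fun hle => hmax hu hle⟩

end RootSys

end ReflOrder

end

open ReflOrder in
theorem mainTheorem10 {n : ℕ} (R : RootSys n) (Ψ : Finset (Fin n → ℝ)) (hΨ : R.IsBase Ψ)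
    (v : Cn n) (hv : R.IsParabolic Ψ (RootSys.stab R.group v))
    (p : Hol n) (hp : ∀ h ∈ RootSys.stab R.group v, pushHol h.toAffineEquiv p = p) :
    (∀ w, R.IsLongestShort Ψ R.group (RootSys.stab R.group v) w →
      ∃ a : ℂ, a ≠ 0 ∧ ∀ F ∈ invHolGerms R.group,
        (R.orbitSum Ψ v p).op F =
          a • (R.divDiff Ψ w * Skew.op (Finsupp.single v (algebraMap (Hol n) (Mer n) p))) F) ∧
    (∀ G', R.IsParabolic Ψ G' →
      ∃ (k : ℕ) (τ : Fin k → (Cn n ≃ₗ[ℂ] Cn n)) (w : Fin k → (Cn n ≃ₗ[ℂ] Cn n))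
        (t r : Fin k → Mer n),
        (∀ s, τ s ∈ R.group) ∧
        (∀ g ∈ R.group, ∃! s, g * (τ s)⁻¹ ∈ G') ∧
        (∀ s, R.IsParabolic Ψ (RootSys.stab G' (τ s v))) ∧
        (∀ s, R.IsLongestShort Ψ G' (RootSys.stab G' (τ s v)) (w s)) ∧
        (∀ s x, (∀ y ∈ R.posRoots Ψ, R.refl y ∉ G' → R.gammaLin y x ≠ 0) →
          RegularAt (t s) x ∧ RegularAt (r s) x) ∧
        (∀ s, IsRational (r s) ∧
          t s = r s * pushMer (τ s).toAffineEquiv (algebraMap (Hol n) (Mer n) p)) ∧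
        ((∃ P, p = polyHol P) → ∀ s, IsRational (t s)) ∧
        ∀ F ∈ invHolGerms R.group,
          (R.orbitSum Ψ v p).op F =
            (∑ s, R.divDiff Ψ (w s) * Skew.op (Finsupp.single (τ s v) (t s))) F) := by
  refine ⟨fun w hw => ?_, fun G' hG' => ?_⟩
  · obtain ⟨a, ha, h⟩ := hw.exists_sum_eq_smul_divDiff hΨ hΨ.isParabolic_group hv inf_le_left
    refine ⟨a, ha, fun F hF => ?_⟩
    rw [RootSys.orbitSum_op p hF, h, Module.End.mul_apply, Skew.op_single]
    intro g hg
    obtain ⟨hg1, hg2⟩ := RootSys.mem_stab.1 hg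
    rw [RootSys.pushOp_mulOp_translation hF hg1, hg2, pushMer_algebraMap, hp g hg]
  · have hKG := hG'.le_group hΨ
    have : Finite G' := Finite.of_injective _ (Subgroup.inclusion_injective hKG)
    let _ : Fintype G' := Fintype.ofFinite G'
    obtain ⟨k, τ, hτ, hcos, hpos⟩ := RootSys.exists_coset_reps hΨ G'
    have hstab : ∀ s, R.IsParabolic Ψ (RootSys.stab G' (τ s v)) := fun s =>
      hΨ.isParabolic_stab hG' hv (hτ s) (hpos s)
    choose w hw using fun s => RootSys.exists_isLongestShort (R := R) (Ψ := Ψ)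
      (H := RootSys.stab G' (τ s v)) hKG inf_le_left
    choose c hc using fun s =>
      RootSys.exists_coset_sum_eq hΨ hG' (hτ s) (hstab s) (hw s) hp
    refine ⟨k, τ, w, _, fun s => polyMer (n := n) (MvPolynomial.C (c s)) /
      polyMer (n := n) (R.polePoly Ψ G' (τ s v)), hτ, hcos, hstab, hw, fun s x hx => ?_,
      fun s => ⟨isRational_polyMer_div _ (RootSys.polePoly_ne_zero _), rfl⟩, ?_, fun F hF => ?_⟩
    · have hr : RegularAt (polyMer (n := n) (MvPolynomial.C (c s)) /
          polyMer (n := n) (R.polePoly Ψ G' (τ s v))) x := by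
        rw [div_eq_mul_inv]
        exact (regularAt_algebraMap _ x).mul
          (regularAt_inv (RootSys.eval_polePoly_ne_zero hx))
      refine ⟨hr.mul ?_, hr⟩
      rw [pushMer_algebraMap]
      exact regularAt_algebraMap _ x
    · rintro ⟨P, rfl⟩ s
      dsimp only
      rw [← polyMer_apply, pushMer_polyMer, div_mul_eq_mul_div, ← RingHom.map_mul]
      exact isRational_polyMer_div _ (RootSys.polePoly_ne_zero _)
    · rw [RootSys.orbitSum_op p hF, RootSys.sum_eq_sum_cosets hKG hτ hcos (fun g =>
        pushOp (n := n) g.toAffineEquiv (mulOp (n := n)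
          (R.delta Ψ (RootSys.stab R.group v) / R.delta Ψ R.group)
          (mulOp (n := n) (algebraMap (Hol n) (Mer n) p) (pushOp (n := n) (translation v) F)))),
        LinearMap.sum_apply]
      refine Finset.sum_congr rfl fun s _ => ?_
      rw [hc s F hF, Module.End.mul_apply, Skew.op_single]
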